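/- Let $\log z = \log|z| + i\arg z$ with $\arg z\in[-\pi/2,3\pi/2)$ for $z\in\mathbb{C}\setminus\{0\}$, and $z^{p}=\exp(p\log z)$ for $p\in\mathbb{R}$. For a complex random variable $Y$ write $\mathrm{Var}(Y)=E\left[|Y-E[Y]|^2\right]$. Let $\mu\in\mathbb{R}$, $\sigma>0$, let $X_1,X_2,\dots$ be i.i.d. random variables with the Cauchy distribution $C(\mu,\sigma)$, i.e. with density $\frac{\sigma}{\pi}\frac{1}{(x-\mu)^2+\sigma^2}$ on $\mathbb{R}$, and let $\alpha\in\mathbb{C}$ with $\mathrm{Im}(\alpha)\ge 0$. Put $$G_n^{(\alpha)}=\prod_{j=1}^{n}(X_j+\alpha)^{1/n}-\alpha ,$$ which is defined almost surely. Then: (i) For every $n\ge 2$, $G_n^{(\alpha)}$ is an unbiased estimator of $\mu+i\sigma$: it is integrable and $E\left[G_n^{(\alpha)}\right]=\mu+i\sigma$. (ii) As $n\to\infty$, $G_n^{(\alpha)}\to\mu+i\sigma$ almost surely, and also in $L^p$ for every $0<p<\infty$ (where $G_n^{(\alpha)}\in L^p$ for all sufficiently large $n$). (iii) It holds that $$\lim_{n\to\infty}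 n\,\mathrm{Var}\left(G_n^{(\alpha)}\right)=2\left((\mu+\mathrm{Re}(\alpha))^2+(\sigma+\mathrm{Im}(\alpha))^2\right)\left(\frac{\sigma}{\pi}\int_{\mathbb{R}}\frac{\arccos\left(x/\sqrt{x^2+\mathrm{Im}(\alpha)^2}\right)^2}{(x-(\mathrm{Re}(\alpha)+\mu))^2+\sigma^2}\,dx-\theta_\alpha^2\right),$$ where the integral converges and $$\theta_\alpha=\arccos\left(\frac{\mu+\mathrm{Re}(\alpha)}{\sqrt{(\mu+\mathrm{Re}(\alpha))^2+(\sigma+\mathrm{Im}(\alpha))^2}}\right).$$ In particular, if $\alpha=0$ and $\mu+i\sigma=re^{i\theta}$ with $r>0$ and $\theta\in(0,\pi)$, then $\lim_{n\to\infty} n\,\mathrm{Var}\left(G_n^{(0)}\right)=2r^2\theta(\pi-\theta)$. -/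

import Mathlib

open MeasureTheory ProbabilityTheory Filter Topology
open scoped NNReal ENNReal

noncomputable section

namespace QuasiMean

/-- The argument of `z` normalised to lie in `[-π/2, 3π/2)`: `Complex.arg` takes values in
`(-π, π]`, and its values below `-π/2` are shifted by `2π`. -/
def argBranch (z : ℂ) : ℝ :=
  if z.arg < -(Real.pi / 2) then z.arg + 2 * Real.pi else z.arg

/-- The branch `log z = log |z| + i θ`, `θ ∈ [-π/2, 3π/2)`, of the logarithm. -/
def logBranch (z : ℂ) : ℂ :=
  (Real.log ‖z‖ : ℂ) + (argBranch z : ℂ) * Complex.I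

/-- `z ^ p = exp (p log z)` for `z ≠ 0`, with the branch `logBranch`; the value at `z = 0`
is set to `0`. -/
def powBranch (z : ℂ) (p : ℝ) : ℂ :=
  if z = 0 then 0 else Complex.exp ((p : ℂ) * logBranch z)

/-- The shifted geometric mean `∏_{j < n} (x_j + α)^{1/n} - α` of `x_0, …, x_{n-1}`. -/
def geomMean (α : ℂ) (n : ℕ) (x : ℕ → ℝ) : ℂ :=
  (∏ j ∈ Finset.range n, powBranch ((x j : ℂ) + α) (1 / (n : ℝ))) - α

/-- The variance `E |Y - E Y|²` of a complex random variable. -/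
def cvar {Ω : Type*} [MeasurableSpace Ω] (Y : Ω → ℂ) (P : Measure Ω) : ℝ :=
  ∫ ω, ‖Y ω - ∫ ω', Y ω' ∂P‖ ^ 2 ∂P

/-- The angle `arccos (x / √(x² + y²))`. -/
def angle (x y : ℝ) : ℝ :=
  Real.arccos (x / Real.sqrt (x ^ 2 + y ^ 2))

end QuasiMean

end

/-! Since `Im α ≥ 0`, every `X_j + α` lies in the closed upper half plane. There the branch used
here is the principal one, so almost surely `G_n + α` is the exponential of the average of the
variables `log (X_j + α)`.

The Cauchy law is the harmonic measure of the half plane seen from `μ + iσ`: the Cayley transform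
carries it to the uniform law on the unit circle. For `0 < p < 1` the function `z ^ p` is
holomorphic on the half plane and grows slowly enough for the mean value property to hold up to the
boundary, so `E (X + α) ^ p = w ^ p` with `w = μ + iσ + α` (`integral_add_cpow`). Independence and
`p = 1 / n` give unbiasedness.

Put `L = log (X + α)` and `l = log w`. Then `E exp (s L) = exp (s l)` for small `s > 0`, and
expanding at `s = 0` gives `E L = l` and `E L ^ 2 = l ^ 2` (`integral_log_add`). The first identity
and the strong law give almost sure convergence. The real part of the second says that `log |X + α|`
and `arg (X + α)` have the same variance `v`.

By independence `E |G_n + α| ^ k = (E exp ((k / n) log |X + α|)) ^ n`, which is `|w| ^ k (1 + k ^ 2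
v / (2 n) + o(1 / n))`. The case `k = 2` is the asymptotic variance. Higher `k` give bounded
moments, and interpolating these against the variance gives convergence in `L^p`. For `α = 0` the
argument only takes the values `0` and `π`, so `E arg ^ 2 = π E arg = π θ`. -/

namespace QuasiMean

/-! ### The Cauchy law as the uniform law on the circle -/

section CauchyMeasure

variable {E : Type*} [NormedAddCommGroup E] [NormedSpace ℝ E] {μ : ℝ} {σ : ℝ≥0}

lemma integrable_cauchyMeasure_iff (hσ : 0 < σ) {f : ℝ → E} :
    Integrable f (cauchyMeasure μ σ) ↔ Integrable (fun x => cauchyPDFReal μ σ x • f x) volume := by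
  rw [cauchyMeasure_of_scale_ne_zero μ hσ.ne', integrable_withDensity_iff_integrable_smul'
    (measurable_cauchyPDF μ σ) (ae_of_all _ fun x => ENNReal.ofReal_lt_top)]
  simp only [cauchyPDF, ENNReal.toReal_ofReal (cauchyPDF_pos μ hσ.ne' _).le]

lemma integral_cauchyMeasure (hσ : 0 < σ) (f : ℝ → E) :
    ∫ x, f x ∂(cauchyMeasure μ σ) = ∫ x, cauchyPDFReal μ σ x • f x := by
  rw [cauchyMeasure_of_scale_ne_zero μ hσ.ne', integral_withDensity_eq_integral_toReal_smul
    (measurable_cauchyPDF μ σ) (ae_of_all _ fun x => ENNReal.ofReal_lt_top)]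
  simp only [cauchyPDF, ENNReal.toReal_ofReal (cauchyPDF_pos μ hσ.ne' _).le]

lemma cauchyMeasure_absolutelyContinuous (hσ : 0 < σ) : cauchyMeasure μ σ ≪ volume := by
  rw [cauchyMeasure_of_scale_ne_zero μ hσ.ne']
  exact withDensity_absolutelyContinuous _ _

/-- The Cayley transform of the real line onto the unit circle that sends `μ` to `1`. -/
noncomputable def cayley (μ : ℝ) (σ : ℝ≥0) (x : ℝ) : ℂ :=
  ((σ : ℝ) + (x - μ : ℝ) * Complex.I) / ((σ : ℝ) - (x - μ : ℝ) * Complex.I)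

lemma cayley_denom_ne_zero (hσ : 0 < σ) (x : ℝ) :
    (((σ : ℝ) : ℂ) - (x - μ : ℝ) * Complex.I) ≠ 0 := by
  intro h
  have := congrArg Complex.re h
  simp at this
  exact hσ.ne' this

lemma norm_cayley (hσ : 0 < σ) (x : ℝ) : ‖cayley μ σ x‖ = 1 := by
  have h := cayley_denom_ne_zero (μ := μ) hσ x
  have h2 : (((σ : ℝ) : ℂ) + (x - μ : ℝ) * Complex.I) =
      (starRingEnd ℂ) (((σ : ℝ) : ℂ) - (x - μ : ℝ) * Complex.I) := by
    simp
  rw [cayley, norm_div, h2, Complex.norm_conj, div_self (norm_ne_zero_iff.2 h)]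

lemma one_add_cayley (hσ : 0 < σ) (x : ℝ) :
    1 + cayley μ σ x = 2 * (σ : ℝ) / ((σ : ℝ) - (x - μ : ℝ) * Complex.I) := by
  have h := cayley_denom_ne_zero (μ := μ) hσ x
  rw [cayley, eq_div_iff h, add_mul, div_mul_cancel₀ _ h]
  ring

lemma exp_two_arctan_mul_I (t : ℝ) :
    Complex.exp ((2 * Real.arctan t : ℝ) * Complex.I) =
      (1 + t * Complex.I) / (1 - t * Complex.I) := by
  have h0 : (1 - t * Complex.I : ℂ) ≠ 0 := by
    intro h
    have := congrArg Complex.re h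
    simp at this
  have h1 : Complex.exp ((Real.arctan t : ℝ) * Complex.I) =
      (Real.cos (Real.arctan t) : ℂ) * (1 + t * Complex.I) := by
    have hs : Real.sin (Real.arctan t) = t * Real.cos (Real.arctan t) := by
      rw [← Real.tan_mul_cos (Real.cos_arctan_pos t).ne', Real.tan_arctan]
    rw [Complex.exp_mul_I, ← Complex.ofReal_cos, ← Complex.ofReal_sin, hs]
    push_cast
    ring
  have h2 : ((Real.cos (Real.arctan t) : ℂ)) ^ 2 * (1 + t ^ 2) = 1 := by
    have h3 := Real.cos_sq_arctan t
    have h4 : Real.cos (Real.arctan t) ^ 2 * (1 + t ^ 2) = 1 := by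
      rw [h3]; field_simp
    exact_mod_cast h4
  have h5 : ((2 * Real.arctan t : ℝ) * Complex.I : ℂ) =
      (Real.arctan t : ℝ) * Complex.I + (Real.arctan t : ℝ) * Complex.I := by
    push_cast; ring
  rw [h5, Complex.exp_add, h1, eq_div_iff h0]
  have hI := Complex.I_sq
  linear_combination (1 + t * Complex.I) * h2 -
    (Real.cos (Real.arctan t) : ℂ) ^ 2 * t ^ 2 * (1 + t * Complex.I) * hI

lemma image_two_arctan (hσ : 0 < σ) :
    (fun x : ℝ => 2 * Real.arctan ((x - μ) / σ)) '' Set.univ =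
      Set.Ioo (-Real.pi) Real.pi := by
  have hσ' : (σ : ℝ) ≠ 0 := by exact_mod_cast hσ.ne'
  ext t
  constructor
  · rintro ⟨x, -, rfl⟩
    have := Real.arctan_mem_Ioo ((x - μ) / σ)
    constructor <;> simp only <;> linarith [this.1, this.2]
  · intro ht
    refine ⟨μ + σ * Real.tan (t / 2), trivial, ?_⟩
    simp only [add_sub_cancel_left, mul_div_cancel_left₀ _ hσ']
    rw [Real.arctan_tan (by linarith [ht.1]) (by linarith [ht.2])]
    ring

/-- The substitution `t = 2 arctan ((x - μ) / σ)` turns the Cauchy density into `dt / 2π` on `(-π,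
π)` and the Cayley transform into `exp (i t)`. The radius `ρ` is kept free so that the mean value
property can be used strictly inside the disc. -/
lemma integral_comp_cayley (hσ : 0 < σ) (f : ℂ → E) (ρ : ℝ) :
    ∫ x, f (ρ * cayley μ σ x) ∂(cauchyMeasure μ σ) = Real.circleAverage f 0 ρ := by
  have hσ' : (0 : ℝ) < σ := by exact_mod_cast hσ
  have hder : ∀ x ∈ Set.univ, HasDerivWithinAt (fun x : ℝ => 2 * Real.arctan ((x - μ) / σ))
      (2 * ((1 / (1 + ((x - μ) / σ) ^ 2)) * (1 / σ))) Set.univ x := by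
    intro x _
    refine (HasDerivAt.const_mul 2 ?_).hasDerivWithinAt
    exact (Real.hasDerivAt_arctan _).comp x (((hasDerivAt_id x).sub_const μ).div_const _)
  have hinj : Set.InjOn (fun x : ℝ => 2 * Real.arctan ((x - μ) / σ)) Set.univ := by
    intro x _ y _ hxy
    have h := Real.arctan_injective (mul_left_cancel₀ two_ne_zero hxy)
    have := (div_left_inj' hσ'.ne').1 h
    linarith
  have key := integral_image_eq_integral_abs_deriv_smul MeasurableSet.univ hder hinj
    (fun t => f (circleMap 0 ρ t))
  rw [image_two_arctan hσ, setIntegral_univ] at key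
  have hper : Function.Periodic (fun θ : ℝ => f (circleMap 0 ρ θ)) (2 * Real.pi) :=
    fun x => by simp [periodic_circleMap 0 ρ x]
  have hshift := hper.intervalIntegral_add_eq 0 (-Real.pi)
  rw [zero_add, show -Real.pi + 2 * Real.pi = Real.pi by ring] at hshift
  rw [Real.circleAverage_def, hshift, intervalIntegral.integral_of_le (by linarith [Real.pi_pos]),
    integral_Ioc_eq_integral_Ioo, key, integral_cauchyMeasure hσ, ← integral_smul]
  congr 1
  ext x
  rw [smul_smul]
  have hU : circleMap 0 ρ (2 * Real.arctan ((x - μ) / σ)) = ρ * cayley μ σ x := by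
    rw [circleMap, zero_add, exp_two_arctan_mul_I, cayley]
    have h : (((σ : ℝ)) : ℂ) ≠ 0 := by exact_mod_cast hσ'.ne'
    congr 1
    rw [← mul_div_mul_left _ _ h]
    congr 1 <;> · push_cast; field_simp
  rw [hU]
  congr 1
  rw [abs_of_pos (by positivity), cauchyPDFReal_def']
  push_cast
  field_simp

end CauchyMeasure

/-! ### Fractional moments by the mean value property -/

section PowerMoments

variable {μ : ℝ} {σ : ℝ≥0}

lemma norm_sub_mul_I_sq (x : ℝ) :
    ‖((σ : ℝ) : ℂ) - (x - μ : ℝ) * Complex.I‖ ^ 2 = (x - μ) ^ 2 + (σ : ℝ) ^ 2 := by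
  rw [← Complex.normSq_eq_norm_sq, Complex.normSq_apply]
  simp
  ring

lemma integrable_cauchyMeasure_norm_rpow (hσ : 0 < σ) {p : ℝ} (hp : p < 1) :
    Integrable (fun x : ℝ => ‖((σ : ℝ) : ℂ) - (x - μ : ℝ) * Complex.I‖ ^ p)
      (cauchyMeasure μ σ) := by
  have hσ' : (0 : ℝ) < σ := by exact_mod_cast hσ
  rw [integrable_cauchyMeasure_iff hσ]
  -- The density decays like `|x| ^ (-2)`, so the integrand decays like `|x| ^ (p - 2)`, and `2 - p
  -- > 1`.
  have h1 : Integrable (fun x : ℝ => ((1 : ℝ) + ‖x‖ ^ 2) ^ (-(2 - p) / 2)) volume :=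
    integrable_rpow_neg_one_add_norm_sq (by simp; linarith)
  have h2 := ((h1.comp_div hσ'.ne').comp_sub_right μ).const_mul (Real.pi⁻¹ * σ * (σ : ℝ) ^ (p - 2))
  refine h2.congr (ae_of_all _ fun x => ?_)
  have hD : ‖((σ : ℝ) : ℂ) - (x - μ : ℝ) * Complex.I‖ =
      σ * (1 + ‖(x - μ) / σ‖ ^ 2) ^ (1 / 2 : ℝ) := by
    rw [← Real.sqrt_eq_rpow, ← sq_eq_sq₀ (norm_nonneg _) (by positivity), norm_sub_mul_I_sq,
      mul_pow, Real.sq_sqrt (by positivity), Real.norm_eq_abs, sq_abs]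
    field_simp
    ring
  set A := 1 + ‖(x - μ) / σ‖ ^ 2 with hA
  have hA0 : 0 < A := by positivity
  have hB : (x - μ) ^ 2 + (σ : ℝ) ^ 2 = σ ^ 2 * A := by
    rw [hA, Real.norm_eq_abs, sq_abs]
    field_simp
    ring
  simp only [smul_eq_mul]
  rw [hD, cauchyPDFReal_def, hB, Real.mul_rpow hσ'.le (by positivity), ← Real.rpow_mul hA0.le,
    show -(2 - p) / 2 = 1 / 2 * p - 1 by ring, Real.rpow_sub_one hA0.ne', Real.rpow_sub hσ',
    Real.rpow_two]
  field_simp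

/-- The conformal map of the unit disc onto the half plane above `Im z = Im α` that sends `0` to
`μ + i σ + α`. -/
noncomputable def discToHalfPlane (μ : ℝ) (σ : ℝ≥0) (α u : ℂ) : ℂ :=
  μ + α + (σ : ℝ) * Complex.I * ((1 - u) / (1 + u))

lemma discToHalfPlane_zero (α : ℂ) :
    discToHalfPlane μ σ α 0 = μ + (σ : ℝ) * Complex.I + α := by
  simp [discToHalfPlane]; ring

lemma discToHalfPlane_cayley (hσ : 0 < σ) (α : ℂ) (x : ℝ) :
    discToHalfPlane μ σ α (cayley μ σ x) = x + α := by
  have hσ' : ((σ : ℝ) : ℂ) ≠ 0 := by exact_mod_cast hσ.ne'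
  have h := cayley_denom_ne_zero (μ := μ) hσ x
  have h1 : 1 - cayley μ σ x = -(2 * (x - μ : ℝ) * Complex.I) /
      ((σ : ℝ) - (x - μ : ℝ) * Complex.I) := by
    rw [cayley, eq_div_iff h, sub_mul, div_mul_cancel₀ _ h]
    ring
  rw [discToHalfPlane, one_add_cayley hσ, h1, div_div_div_cancel_right₀ h]
  field_simp
  push_cast
  linear_combination (-(x - μ) : ℂ) * Complex.I_sq

lemma one_add_ne_zero_of_norm_lt_one {u : ℂ} (hu : ‖u‖ < 1) : 1 + u ≠ 0 := by
  intro h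
  have : u = -1 := by linear_combination h
  rw [this] at hu
  simp at hu

lemma discToHalfPlane_im_pos (hσ : 0 < σ) {α : ℂ} (hα : 0 ≤ α.im) {u : ℂ} (hu : ‖u‖ < 1) :
    0 < (discToHalfPlane μ σ α u).im := by
  have hσ' : (0 : ℝ) < σ := by exact_mod_cast hσ
  have h0 := one_add_ne_zero_of_norm_lt_one hu
  have hre : 0 < ((1 - u) / (1 + u)).re := by
    rw [Complex.div_re, ← add_div]
    refine div_pos ?_ (Complex.normSq_pos.2 h0)
    have h1 : Complex.normSq u < 1 := by
      rw [Complex.normSq_eq_norm_sq]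
      nlinarith [norm_nonneg u]
    rw [Complex.normSq_apply] at h1
    simp
    nlinarith
  have him : (discToHalfPlane μ σ α u).im = α.im + σ * ((1 - u) / (1 + u)).re := by
    simp [discToHalfPlane, Complex.mul_im, Complex.mul_re]
  rw [him]
  positivity

/-- Moving radially inwards brings a point at most a factor `2` closer to the pole `-1` of
`discToHalfPlane`, because the distance moved is at most `1 - ρ`, itself at most the new distance to
`-1`. This makes the domination below uniform in `ρ`. -/
lemma norm_one_add_le_two_mul {ζ : ℂ} (hζ : ‖ζ‖ ≤ 1) {ρ : ℝ} (h0 : 0 ≤ ρ) (h1 : ρ ≤ 1) :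
    ‖1 + ζ‖ ≤ 2 * ‖1 + ρ * ζ‖ := by
  have e1 : 1 + ζ = (1 + ρ * ζ) + ((1 - ρ : ℝ) : ℂ) * ζ := by push_cast; ring
  have e2 : ‖((1 - ρ : ℝ) : ℂ) * ζ‖ ≤ 1 - ρ := by
    rw [norm_mul, Complex.norm_real, Real.norm_of_nonneg (by linarith)]
    nlinarith [norm_nonneg ζ]
  have e3 : 1 - ρ ≤ ‖1 + ρ * ζ‖ := by
    have h := norm_sub_norm_le (1 : ℂ) (-(ρ * ζ))
    rw [sub_neg_eq_add, norm_neg, norm_mul, Complex.norm_real, Real.norm_of_nonneg h0,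
      norm_one] at h
    nlinarith [norm_nonneg ζ]
  calc ‖1 + ζ‖ ≤ ‖1 + ρ * ζ‖ + ‖((1 - ρ : ℝ) : ℂ) * ζ‖ := by
        conv_lhs => rw [e1]
        exact norm_add_le _ _
    _ ≤ 2 * ‖1 + ρ * ζ‖ := by linarith

lemma norm_discToHalfPlane_le (α : ℂ) {u : ℂ} (hu : ‖u‖ ≤ 1) (h : 1 + u ≠ 0) :
    ‖discToHalfPlane μ σ α u‖ ≤ 2 * (‖(μ : ℂ) + α‖ + σ) / ‖1 + u‖ := by
  have hpos : 0 < ‖1 + u‖ := norm_pos_iff.2 h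
  have h2 : ‖1 + u‖ ≤ 2 := (norm_add_le _ _).trans (by rw [norm_one]; linarith)
  have h3 : ‖1 - u‖ ≤ 2 := (norm_sub_le _ _).trans (by rw [norm_one]; linarith)
  calc ‖discToHalfPlane μ σ α u‖ ≤ ‖(μ : ℂ) + α‖ + σ * (‖1 - u‖ / ‖1 + u‖) := by
        refine (norm_add_le _ _).trans ?_
        simp
    _ ≤ ‖(μ : ℂ) + α‖ * (2 / ‖1 + u‖) + σ * (2 / ‖1 + u‖) := by
        gcongr
        have : 1 ≤ 2 / ‖1 + u‖ := by rwa [le_div_iff₀ hpos, one_mul]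
        nlinarith [norm_nonneg ((μ : ℂ) + α)]
    _ = _ := by ring

lemma norm_discToHalfPlane_mul_cayley_le (hσ : 0 < σ) (α : ℂ) {ρ : ℝ} (h0 : 0 ≤ ρ) (h1 : ρ ≤ 1)
    (x : ℝ) : ‖discToHalfPlane μ σ α (ρ * cayley μ σ x)‖ ≤
      2 * (‖(μ : ℂ) + α‖ + σ) / σ * ‖((σ : ℝ) : ℂ) - (x - μ : ℝ) * Complex.I‖ := by
  have hσ' : (0 : ℝ) < σ := by exact_mod_cast hσ
  have hU := norm_cayley (μ := μ) hσ x
  have hD : 0 < ‖((σ : ℝ) : ℂ) - (x - μ : ℝ) * Complex.I‖ :=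
    norm_pos_iff.2 (cayley_denom_ne_zero hσ x)
  have hle := norm_one_add_le_two_mul hU.le h0 h1
  have hone : ‖1 + cayley μ σ x‖ = 2 * σ / ‖((σ : ℝ) : ℂ) - (x - μ : ℝ) * Complex.I‖ := by
    rw [one_add_cayley hσ, norm_div, norm_mul]
    simp
  have hlow : σ / ‖((σ : ℝ) : ℂ) - (x - μ : ℝ) * Complex.I‖ ≤ ‖1 + ρ * cayley μ σ x‖ := by
    rw [hone] at hle
    have : 2 * (σ : ℝ) / ‖((σ : ℝ) : ℂ) - (x - μ : ℝ) * Complex.I‖ =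
      2 * (σ / ‖((σ : ℝ) : ℂ) - (x - μ : ℝ) * Complex.I‖) := by ring
    linarith
  have hpos : 0 < σ / ‖((σ : ℝ) : ℂ) - (x - μ : ℝ) * Complex.I‖ := by positivity
  have hne : 1 + ρ * cayley μ σ x ≠ 0 := norm_pos_iff.1 (hpos.trans_le hlow)
  have hle1 : ‖(ρ : ℂ) * cayley μ σ x‖ ≤ 1 := by
    rw [norm_mul, hU, Complex.norm_real, Real.norm_of_nonneg h0, mul_one]
    exact h1
  calc _ ≤ 2 * (‖(μ : ℂ) + α‖ + σ) / ‖1 + ρ * cayley μ σ x‖ := norm_discToHalfPlane_le α hle1 hne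
    _ ≤ 2 * (‖(μ : ℂ) + α‖ + σ) / (σ / ‖((σ : ℝ) : ℂ) - (x - μ : ℝ) * Complex.I‖) := by gcongr
    _ = _ := by field_simp

/-- On the cut the principal logarithm is still continuous from above, and the radial limits
approach the real line only from that side. -/
lemma continuousWithinAt_log_upperHalf {z : ℂ} (hz : z ≠ 0) :
    ContinuousWithinAt Complex.log {z : ℂ | 0 ≤ z.im} z := by
  by_cases hs : z ∈ Complex.slitPlane
  · exact (continuousAt_clog hs).continuousWithinAt
  · rw [Complex.mem_slitPlane_iff, not_or, not_lt, not_not] at hs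
    refine Complex.continuousWithinAt_log_of_re_neg_of_im_zero (lt_of_le_of_ne hs.1 ?_) hs.2
    intro h
    exact hz (Complex.ext h hs.2)

lemma continuousWithinAt_cpow_upperHalf {z : ℂ} (hz : z ≠ 0) (p : ℂ) :
    ContinuousWithinAt (fun z : ℂ => z ^ p) {z : ℂ | 0 ≤ z.im} z := by
  have h : ContinuousWithinAt (fun z => Complex.exp (Complex.log z * p)) {z : ℂ | 0 ≤ z.im} z :=
    ((continuousWithinAt_log_upperHalf hz).mul_const p).cexp
  refine h.congr_of_eventuallyEq ?_ (Complex.cpow_def_of_ne_zero hz p)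
  filter_upwards [mem_nhdsWithin_of_mem_nhds (isOpen_ne.mem_nhds hz)] with y hy
  exact Complex.cpow_def_of_ne_zero hy p

lemma ae_add_ne_zero (hσ : 0 < σ) (α : ℂ) : ∀ᵐ x : ℝ ∂(cauchyMeasure μ σ), (x : ℂ) + α ≠ 0 := by
  refine (cauchyMeasure_absolutelyContinuous hσ).ae_le ?_
  filter_upwards [(Set.countable_singleton (-α.re)).ae_notMem volume] with x hx h
  refine hx ?_
  have := congrArg Complex.re h
  simp at this
  simp
  linarith

@[fun_prop]
lemma measurable_cayley : Measurable (cayley μ σ) := by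
  unfold cayley
  fun_prop

@[fun_prop]
lemma measurable_discToHalfPlane (α : ℂ) : Measurable (discToHalfPlane μ σ α) := by
  unfold discToHalfPlane
  fun_prop

lemma integrable_norm_add_rpow (hσ : 0 < σ) (α : ℂ) {p : ℝ} (hp0 : 0 ≤ p) (hp : p < 1) :
    Integrable (fun x : ℝ => ‖(x : ℂ) + α‖ ^ p) (cauchyMeasure μ σ) := by
  refine ((integrable_cauchyMeasure_norm_rpow (μ := μ) hσ hp).const_mul
    ((2 * (‖(μ : ℂ) + α‖ + σ) / σ) ^ p)).mono' ?_ (ae_of_all _ fun x => ?_)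
  · exact (by fun_prop : Measurable fun x : ℝ => ‖(x : ℂ) + α‖ ^ p).aestronglyMeasurable
  · have h := norm_discToHalfPlane_mul_cayley_le (μ := μ) hσ α zero_le_one le_rfl x
    rw [Complex.ofReal_one, one_mul, discToHalfPlane_cayley hσ] at h
    rw [Real.norm_of_nonneg (by positivity), ← Real.mul_rpow (by positivity) (by positivity)]
    exact Real.rpow_le_rpow (norm_nonneg _) h hp0

/-- Fractional moments of a shifted Cauchy variable. -/
lemma integral_add_cpow (hσ : 0 < σ) {α : ℂ} (hα : 0 ≤ α.im) {p : ℝ} (hp0 : 0 < p) (hp : p < 1) :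
    ∫ x : ℝ, ((x : ℂ) + α) ^ (p : ℂ) ∂(cauchyMeasure μ σ) =
      ((μ : ℂ) + (σ : ℝ) * Complex.I + α) ^ (p : ℂ) := by
  set g : ℂ → ℂ := fun u => discToHalfPlane μ σ α u ^ (p : ℂ) with hg
  have hmem : Set.Ioo (0 : ℝ) 1 ∈ 𝓝[<] (1 : ℝ) := Ioo_mem_nhdsLT zero_lt_one
  -- On the unit circle itself `g` may be singular, so the mean value property is applied at radius
  -- `ρ < 1`, and `ρ → 1` by dominated convergence.
  have hlim : Tendsto (fun ρ : ℝ => ∫ x, g (ρ * cayley μ σ x) ∂(cauchyMeasure μ σ)) (𝓝[<] 1)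
      (𝓝 (∫ x : ℝ, ((x : ℂ) + α) ^ (p : ℂ) ∂(cauchyMeasure μ σ))) := by
    refine tendsto_integral_filter_of_dominated_convergence
      (fun x => (2 * (‖(μ : ℂ) + α‖ + σ) / σ) ^ p *
        ‖((σ : ℝ) : ℂ) - (x - μ : ℝ) * Complex.I‖ ^ p) ?_ ?_ ?_ ?_
    · refine Eventually.of_forall fun ρ => Measurable.aestronglyMeasurable ?_
      rw [hg]
      fun_prop
    · filter_upwards [hmem] with ρ hρ
      refine ae_of_all _ fun x => ?_
      rw [hg, Complex.norm_cpow_real, ← Real.mul_rpow (by positivity) (by positivity)]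
      exact Real.rpow_le_rpow (norm_nonneg _)
        (norm_discToHalfPlane_mul_cayley_le hσ α hρ.1.le hρ.2.le x) hp0.le
    · exact (integrable_cauchyMeasure_norm_rpow hσ hp).const_mul _
    · filter_upwards [ae_add_ne_zero hσ α] with x hx
      refine (continuousWithinAt_cpow_upperHalf hx (p : ℂ)).tendsto.comp ?_
      refine tendsto_nhdsWithin_iff.2 ⟨?_, ?_⟩
      · rw [← discToHalfPlane_cayley (μ := μ) hσ α x]
        have hne : 1 + cayley μ σ x ≠ 0 := by
          rw [one_add_cayley hσ]
          refine div_ne_zero (mul_ne_zero two_ne_zero ?_) (cayley_denom_ne_zero hσ x)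
          exact_mod_cast hσ.ne'
        have hc : ContinuousAt (fun ρ : ℝ => discToHalfPlane μ σ α (ρ * cayley μ σ x)) 1 := by
          unfold discToHalfPlane
          have hne' : 1 + ((1 : ℝ) : ℂ) * cayley μ σ x ≠ 0 := by simpa using hne
          fun_prop (disch := assumption)
        have := hc.tendsto
        simp only [Complex.ofReal_one, one_mul] at this
        exact this.mono_left nhdsWithin_le_nhds
      · filter_upwards [hmem] with ρ hρ
        refine (discToHalfPlane_im_pos hσ hα ?_).le
        rw [norm_mul, norm_cayley hσ, Complex.norm_real, Real.norm_of_nonneg hρ.1.le, mul_one]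
        exact hρ.2
  -- For each `ρ < 1` the integral is a circle average of a holomorphic function, hence equal to `g
  -- 0` whatever `ρ` is.
  refine tendsto_nhds_unique hlim (tendsto_const_nhds.congr' ?_)
  filter_upwards [hmem] with ρ hρ
  rw [integral_comp_cayley hσ, DiffContOnCl.circleAverage]
  · rw [hg]
    simp only [discToHalfPlane_zero]
  · refine DifferentiableOn.diffContOnCl fun u hu => DifferentiableAt.differentiableWithinAt ?_
    have hu1 : ‖u‖ < 1 := by
      have : u ∈ Metric.closedBall (0 : ℂ) |ρ| := Metric.closure_ball_subset_closedBall hu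
      rw [mem_closedBall_zero_iff, abs_of_pos hρ.1] at this
      linarith [hρ.2]
    have hne := one_add_ne_zero_of_norm_lt_one hu1
    have hsl : discToHalfPlane μ σ α u ∈ Complex.slitPlane :=
      Complex.mem_slitPlane_iff.2 (Or.inr (discToHalfPlane_im_pos hσ hα hu1).ne')
    refine DifferentiableAt.cpow_const ?_ hsl
    unfold discToHalfPlane
    fun_prop (disch := assumption)

end PowerMoments

/-! ### Expansion of moment generating functions at zero -/

section ExponentialMoments

lemma norm_exp_sub_one_sub_le (z : ℂ) :
    ‖Complex.exp z - 1 - z‖ ≤ ‖z‖ ^ 2 * Real.exp ‖z‖ := by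
  have h := Complex.norm_exp_sub_sum_le_norm_mul_exp z 2
  simpa [Finset.sum_range_succ, sub_sub] using h

lemma norm_exp_sub_one_sub_sub_le (z : ℂ) :
    ‖Complex.exp z - 1 - z - z ^ 2 / 2‖ ≤ ‖z‖ ^ 3 * Real.exp ‖z‖ := by
  have h := Complex.norm_exp_sub_sum_le_norm_mul_exp z 3
  simpa [Finset.sum_range_succ, sub_sub, add_assoc] using h

lemma tendsto_exp_sub_one_sub_div_sq (z : ℂ) :
    Tendsto (fun s : ℝ => (Complex.exp (s * z) - 1 - s * z) / (s : ℂ) ^ 2) (𝓝[>] 0)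
      (𝓝 (z ^ 2 / 2)) := by
  rw [tendsto_iff_norm_sub_tendsto_zero]
  have hlim : Tendsto (fun s : ℝ => s * (‖z‖ ^ 3 * Real.exp (s * ‖z‖))) (𝓝[>] 0) (𝓝 0) := by
    have hc : Continuous fun s : ℝ => s * (‖z‖ ^ 3 * Real.exp (s * ‖z‖)) := by fun_prop
    have := hc.tendsto 0
    simp only [zero_mul] at this
    exact this.mono_left nhdsWithin_le_nhds
  refine squeeze_zero' (Eventually.of_forall fun _ => norm_nonneg _) ?_ hlim
  filter_upwards [self_mem_nhdsWithin] with s hs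
  have hs0 : (0 : ℝ) < s := hs
  have hsc : (s : ℂ) ≠ 0 := by exact_mod_cast hs0.ne'
  have e : (Complex.exp (s * z) - 1 - s * z) / (s : ℂ) ^ 2 - z ^ 2 / 2 =
      (Complex.exp (s * z) - 1 - s * z - (s * z) ^ 2 / 2) / (s : ℂ) ^ 2 := by
    field_simp
  have hb := norm_exp_sub_one_sub_sub_le (s * z)
  rw [norm_mul, Complex.norm_real, Real.norm_of_nonneg hs0.le] at hb
  rw [e, norm_div, norm_pow, Complex.norm_real, Real.norm_of_nonneg hs0.le,
    div_le_iff₀ (by positivity)]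
  refine hb.trans (le_of_eq ?_)
  ring

variable {Ω : Type*} [MeasurableSpace Ω] {P : Measure Ω} {V : Ω → ℂ} {ε : ℝ}

/-- Half of the exponential rate absorbs the square; the constant comes from `(ε t / 2) ^ 2 / 2! ≤
exp (ε t / 2)`. -/
lemma sq_mul_exp_le (hε : 0 < ε) {t : ℝ} (ht : 0 ≤ t) :
    t ^ 2 * Real.exp (ε / 2 * t) ≤ 8 / ε ^ 2 * Real.exp (ε * t) := by
  have h := Real.pow_div_factorial_le_exp (x := ε / 2 * t) (by positivity) 2
  have h2 : t ^ 2 ≤ 8 / ε ^ 2 * Real.exp (ε / 2 * t) := by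
    rw [div_mul_eq_mul_div, le_div_iff₀ (by positivity)]
    norm_num [Nat.factorial] at h
    nlinarith
  calc t ^ 2 * Real.exp (ε / 2 * t)
      ≤ (8 / ε ^ 2 * Real.exp (ε / 2 * t)) * Real.exp (ε / 2 * t) := by gcongr
    _ = 8 / ε ^ 2 * Real.exp (ε * t) := by
        rw [mul_assoc, ← Real.exp_add]
        ring_nf

lemma integrable_norm_sq_of_exp (hε : 0 < ε) (hV : AEStronglyMeasurable V P)
    (hint : Integrable (fun ω => Real.exp (ε * ‖V ω‖)) P) :
    Integrable (fun ω => ‖V ω‖ ^ 2) P := by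
  refine (hint.const_mul (8 / ε ^ 2)).mono' (by fun_prop) (ae_of_all _ fun ω => ?_)
  rw [Real.norm_of_nonneg (by positivity)]
  refine le_trans ?_ (sq_mul_exp_le hε (norm_nonneg (V ω)))
  exact le_mul_of_one_le_right (by positivity) (Real.one_le_exp (by positivity))

lemma integrable_sq_of_exp (hε : 0 < ε) (hV : AEStronglyMeasurable V P)
    (hint : Integrable (fun ω => Real.exp (ε * ‖V ω‖)) P) :
    Integrable (fun ω => V ω ^ 2) P :=
  (integrable_norm_sq_of_exp hε hV hint).mono' (by fun_prop)
    (ae_of_all _ fun ω => by rw [norm_pow])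

lemma integrable_of_exp (hε : 0 < ε) (hV : AEStronglyMeasurable V P)
    (hint : Integrable (fun ω => Real.exp (ε * ‖V ω‖)) P) : Integrable V P := by
  refine (hint.const_mul ε⁻¹).mono' hV (ae_of_all _ fun ω => ?_)
  have h := Real.add_one_le_exp (ε * ‖V ω‖)
  rw [← div_eq_inv_mul, le_div_iff₀ hε]
  linarith

lemma integrable_cexp_of_exp {s : ℝ} (hs : |s| ≤ ε) (hV : AEStronglyMeasurable V P)
    (hint : Integrable (fun ω => Real.exp (ε * ‖V ω‖)) P) :
    Integrable (fun ω => Complex.exp (s * V ω)) P := by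
  refine hint.mono' (by fun_prop) (ae_of_all _ fun ω => ?_)
  refine (Complex.norm_exp_le_exp_norm _).trans (Real.exp_le_exp.2 ?_)
  rw [norm_mul, Complex.norm_real, Real.norm_eq_abs]
  gcongr

/-- Second order expansion at `0` of the moment generating function. -/
lemma tendsto_integral_exp_sub_div_sq [IsProbabilityMeasure P] (hε : 0 < ε)
    (hV : AEStronglyMeasurable V P) (hint : Integrable (fun ω => Real.exp (ε * ‖V ω‖)) P) :
    Tendsto (fun s : ℝ => (∫ ω, Complex.exp (s * V ω) ∂P - 1 - s * ∫ ω, V ω ∂P) / (s : ℂ) ^ 2)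
      (𝓝[>] 0) (𝓝 ((∫ ω, V ω ^ 2 ∂P) / 2)) := by
  have hmem : Set.Ioo (0 : ℝ) (ε / 2) ∈ 𝓝[>] (0 : ℝ) := Ioo_mem_nhdsGT (by positivity)
  have hlim : Tendsto (fun s : ℝ =>
      ∫ ω, (Complex.exp (s * V ω) - 1 - s * V ω) / (s : ℂ) ^ 2 ∂P)
      (𝓝[>] 0) (𝓝 (∫ ω, V ω ^ 2 / 2 ∂P)) := by
    refine tendsto_integral_filter_of_dominated_convergence
      (fun ω => 8 / ε ^ 2 * Real.exp (ε * ‖V ω‖)) ?_ ?_ (hint.const_mul _)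
      (ae_of_all _ fun ω => tendsto_exp_sub_one_sub_div_sq (V ω))
    · exact Eventually.of_forall fun s => by fun_prop
    · filter_upwards [hmem] with s hs
      refine ae_of_all _ fun ω => ?_
      have hs0 : 0 < s := hs.1
      have hb := norm_exp_sub_one_sub_le (s * V ω)
      rw [norm_mul, Complex.norm_real, Real.norm_of_nonneg hs0.le] at hb
      rw [norm_div, norm_pow, Complex.norm_real, Real.norm_of_nonneg hs0.le,
        div_le_iff₀ (by positivity)]
      have h2 : Real.exp (s * ‖V ω‖) ≤ Real.exp (ε / 2 * ‖V ω‖) :=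
        Real.exp_le_exp.2 (by have := hs.2.le; gcongr)
      calc _ ≤ (s * ‖V ω‖) ^ 2 * Real.exp (s * ‖V ω‖) := hb
        _ ≤ (s * ‖V ω‖) ^ 2 * Real.exp (ε / 2 * ‖V ω‖) := by gcongr
        _ = (‖V ω‖ ^ 2 * Real.exp (ε / 2 * ‖V ω‖)) * s ^ 2 := by ring
        _ ≤ _ := by gcongr ?_ * s ^ 2; exact sq_mul_exp_le hε (norm_nonneg (V ω))
  rw [integral_div] at hlim
  refine hlim.congr' ?_
  filter_upwards [hmem] with s hs
  have hs' : |s| ≤ ε := by rw [abs_of_pos hs.1]; linarith [hs.2]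
  have hi1 := integrable_cexp_of_exp hs' hV hint
  have hi2 := (integrable_of_exp hε hV hint).const_mul (s : ℂ)
  have hi3 : Integrable (fun ω => Complex.exp (s * V ω) - 1) P := hi1.sub (integrable_const 1)
  rw [integral_div, integral_sub hi3 hi2, integral_sub hi1 (integrable_const 1), integral_const_mul]
  simp

/-- The first two moments are read off from the moment generating function. -/
lemma integral_eq_of_mgf_eq_exp [IsProbabilityMeasure P] (hε : 0 < ε)
    (hV : AEStronglyMeasurable V P) (hint : Integrable (fun ω => Real.exp (ε * ‖V ω‖)) P)
    {l : ℂ} (h : ∀ᶠ s : ℝ in 𝓝[>] 0, ∫ ω, Complex.exp (s * V ω) ∂P = Complex.exp (s * l)) :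
    ∫ ω, V ω ∂P = l ∧ ∫ ω, V ω ^ 2 ∂P = l ^ 2 := by
  have h1 := tendsto_integral_exp_sub_div_sq hε hV hint
  have h2 := tendsto_exp_sub_one_sub_div_sq l
  have hfst : ∫ ω, V ω ∂P = l := by
    have h3 : Tendsto (fun s : ℝ => (s : ℂ)) (𝓝[>] 0) (𝓝 0) := by
      have := Complex.continuous_ofReal.tendsto 0
      rw [Complex.ofReal_zero] at this
      exact this.mono_left nhdsWithin_le_nhds
    -- The two generating functions agree, so the difference of the expansions is `(l - E V) / s`.
    -- It has a finite limit, so `s` times it tends to `0`.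
    have h4 := h3.mul (h1.sub h2)
    rw [zero_mul] at h4
    have h5 : Tendsto (fun _ : ℝ => l - ∫ ω, V ω ∂P) (𝓝[>] 0) (𝓝 0) := by
      refine h4.congr' ?_
      filter_upwards [h, self_mem_nhdsWithin] with s hs hs0
      have hsc : (s : ℂ) ≠ 0 := by exact_mod_cast (ne_of_gt hs0)
      rw [hs]
      field_simp
      ring
    exact (sub_eq_zero.1 (tendsto_nhds_unique tendsto_const_nhds h5)).symm
  refine ⟨hfst, ?_⟩
  have h6 : (∫ ω, V ω ^ 2 ∂P) / 2 = l ^ 2 / 2 := by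
    refine tendsto_nhds_unique h1 (h2.congr' ?_)
    filter_upwards [h] with s hs
    rw [hs, hfst]
  linear_combination 2 * h6

lemma tendsto_integral_rexp_sub_div_sq [IsProbabilityMeasure P] (hε : 0 < ε) {Y : Ω → ℝ}
    (hY : AEStronglyMeasurable Y P) (hint : Integrable (fun ω => Real.exp (ε * |Y ω|)) P) :
    Tendsto (fun s : ℝ => (∫ ω, Real.exp (s * Y ω) ∂P - 1 - s * ∫ ω, Y ω ∂P) / s ^ 2)
      (𝓝[>] 0) (𝓝 ((∫ ω, Y ω ^ 2 ∂P) / 2)) := by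
  have h := tendsto_integral_exp_sub_div_sq (V := fun ω => (Y ω : ℂ)) hε
    (Complex.continuous_ofReal.comp_aestronglyMeasurable hY)
    (by simpa only [Complex.norm_real, Real.norm_eq_abs] using hint)
  have h2 := (Complex.continuous_re.tendsto _).comp h
  have e1 : ∀ s : ℝ, ∫ ω, Complex.exp (s * (Y ω : ℂ)) ∂P =
      ((∫ ω, Real.exp (s * Y ω) ∂P : ℝ) : ℂ) := by
    intro s
    rw [← integral_complex_ofReal]
    congr 1
    ext ω
    push_cast
    rfl
  have e2 : ∫ ω, (Y ω : ℂ) ∂P = ((∫ ω, Y ω ∂P : ℝ) : ℂ) := integral_ofReal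
  have e3 : ∫ ω, (Y ω : ℂ) ^ 2 ∂P = ((∫ ω, Y ω ^ 2 ∂P : ℝ) : ℂ) := by
    rw [← integral_complex_ofReal]
    congr 1
    ext ω
    push_cast
    rfl
  rw [e2, e3] at h2
  have e4 : ((((∫ ω, Y ω ^ 2 ∂P : ℝ) : ℂ)) / 2).re = (∫ ω, Y ω ^ 2 ∂P) / 2 := by
    rw [show ((((∫ ω, Y ω ^ 2 ∂P : ℝ) : ℂ)) / 2) = (((∫ ω, Y ω ^ 2 ∂P) / 2 : ℝ) : ℂ) by push_cast; rfl,
      Complex.ofReal_re]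
  rw [e4] at h2
  refine h2.congr fun s => ?_
  simp only [Function.comp]
  rw [e1]
  norm_cast

/-- Bernoulli's inequality bounds `(1 + t n) ^ n - 1` below by `n t`, and `exp (n t) - 1 ≤ n t + (n
t) ^ 2` bounds it above. The two bounds differ by `O(1 / n ^ 2)`. -/
lemma tendsto_mul_one_add_pow_sub_one {t : ℕ → ℝ} {c : ℝ}
    (ht : Tendsto (fun n : ℕ => (n : ℝ) ^ 2 * t n) atTop (𝓝 c)) :
    Tendsto (fun n : ℕ => (n : ℝ) * ((1 + t n) ^ n - 1)) atTop (𝓝 c) := by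
  have hinv : Tendsto (fun n : ℕ => ((n : ℝ))⁻¹) atTop (𝓝 0) := tendsto_inv_atTop_nhds_zero_nat
  have h1 : Tendsto (fun n : ℕ => (n : ℝ) * t n) atTop (𝓝 0) := by
    have := hinv.mul ht
    rw [zero_mul] at this
    refine this.congr' ?_
    filter_upwards [eventually_gt_atTop 0] with n hn
    have : (n : ℝ) ≠ 0 := by positivity
    field_simp
  have h0 : Tendsto t atTop (𝓝 0) := by
    have := hinv.mul h1
    rw [zero_mul] at this
    refine this.congr' ?_
    filter_upwards [eventually_gt_atTop 0] with n hn
    have : (n : ℝ) ≠ 0 := by positivity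
    field_simp
  have hupper : Tendsto (fun n : ℕ => (n : ℝ) ^ 2 * t n + ((n : ℝ) ^ 2 * t n) * ((n : ℝ) * t n))
      atTop (𝓝 c) := by
    simpa using ht.add (ht.mul h1)
  refine tendsto_of_tendsto_of_tendsto_of_le_of_le' ht hupper ?_ ?_
  · filter_upwards [h0.eventually (lt_mem_nhds (show (-1 : ℝ) < 0 by norm_num))] with n hn
    have := one_add_mul_le_pow (show (-2 : ℝ) ≤ t n by linarith) n
    nlinarith [Nat.cast_nonneg (α := ℝ) n]
  · filter_upwards [h0.eventually (lt_mem_nhds (show (-1 : ℝ) < 0 by norm_num)),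
      (h1.norm.eventually (gt_mem_nhds (show ‖(0 : ℝ)‖ < 1 by simp)))] with n hn hn1
    have hexp : (1 + t n) ^ n ≤ Real.exp (n * t n) := by
      rw [Real.exp_nat_mul]
      refine pow_le_pow_left₀ (by linarith) ?_ n
      linarith [Real.add_one_le_exp (t n)]
    have h3 := (abs_le.1 (Real.norm_exp_sub_one_sub_id_le hn1.le)).2
    rw [Real.norm_eq_abs, sq_abs] at h3
    nlinarith [Nat.cast_nonneg (α := ℝ) n]

/-- If `m` is the mean of `Y`, the `n`-th power of `E exp (q Y / n)` is `exp (q m)` up to an error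
of order `1 / n` that is governed by the variance. -/
lemma tendsto_mul_mgf_pow_sub [IsProbabilityMeasure P] (hε : 0 < ε) {Y : Ω → ℝ}
    (hY : AEStronglyMeasurable Y P) (hint : Integrable (fun ω => Real.exp (ε * |Y ω|)) P)
    {m : ℝ} (hm : ∫ ω, Y ω ∂P = m) {q : ℝ} (hq : 0 < q) :
    Tendsto (fun n : ℕ => (n : ℝ) * ((∫ ω, Real.exp (q / n * Y ω) ∂P) ^ n - Real.exp (q * m)))
      atTop (𝓝 (Real.exp (q * m) * (q ^ 2 / 2 * (∫ ω, Y ω ^ 2 ∂P - m ^ 2)))) := by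
  have hYc := Complex.continuous_ofReal.comp_aestronglyMeasurable hY
  have hintc : Integrable (fun ω => Real.exp (ε * ‖(Y ω : ℂ)‖)) P := by
    simpa only [Complex.norm_real, Real.norm_eq_abs] using hint
  have hYi : Integrable Y P := (integrable_of_exp (V := fun ω => (Y ω : ℂ)) hε hYc hintc).re
  have hY2 : Integrable (fun ω => Y ω ^ 2) P := by
    have := integrable_norm_sq_of_exp (V := fun ω => (Y ω : ℂ)) hε hYc hintc
    simpa using this
  have hcent : Integrable (fun ω => Real.exp (ε * |Y ω - m|)) P := by
    refine (hint.const_mul (Real.exp (ε * |m|))).mono' (by fun_prop) (ae_of_all _ fun ω => ?_)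
    rw [Real.norm_of_nonneg (Real.exp_pos _).le, ← Real.exp_add, Real.exp_le_exp, ← mul_add]
    gcongr
    rw [add_comm]
    exact abs_sub _ _
  -- Centring removes the linear term, so that `E exp (q (Y - m) / n) - 1` is of order `1 / n ^ 2`,
  -- as the lemma on `(1 + t n) ^ n` requires.
  have key := tendsto_integral_rexp_sub_div_sq hε (hY.sub aestronglyMeasurable_const) hcent
  have hzero : ∫ ω, (Y ω - m) ∂P = 0 := by
    rw [integral_sub hYi (integrable_const m), hm]; simp
  have hvar : ∫ ω, (Y ω - m) ^ 2 ∂P = ∫ ω, Y ω ^ 2 ∂P - m ^ 2 := by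
    have e : ∀ ω, (Y ω - m) ^ 2 = Y ω ^ 2 - 2 * m * Y ω + m ^ 2 := fun ω => by ring
    simp_rw [e]
    have hi : Integrable (fun ω => Y ω ^ 2 - 2 * m * Y ω) P := hY2.sub (hYi.const_mul _)
    rw [integral_add hi (integrable_const _), integral_sub hY2 (hYi.const_mul _), integral_const_mul, hm]
    simp
    ring
  simp only [Pi.sub_apply, hzero, hvar, mul_zero, sub_zero] at key
  have hs : Tendsto (fun n : ℕ => q / (n : ℝ)) atTop (𝓝[>] 0) := by
    refine tendsto_nhdsWithin_iff.2 ⟨tendsto_const_div_atTop_nhds_zero_nat q, ?_⟩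
    filter_upwards [eventually_gt_atTop 0] with n hn
    exact div_pos hq (by exact_mod_cast hn)
  have key2 := (key.comp hs).const_mul (q ^ 2)
  have key3 : Tendsto (fun n : ℕ => (n : ℝ) ^ 2 *
      (∫ ω, Real.exp (q / n * (Y ω - m)) ∂P - 1)) atTop
      (𝓝 (q ^ 2 * ((∫ ω, Y ω ^ 2 ∂P - m ^ 2) / 2))) := by
    refine key2.congr' ?_
    filter_upwards [eventually_gt_atTop 0] with n hn
    have : (n : ℝ) ≠ 0 := by positivity
    simp only [Function.comp]
    field_simp
  have key4 := (tendsto_mul_one_add_pow_sub_one key3).const_mul (Real.exp (q * m))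
  rw [show q ^ 2 * ((∫ ω, Y ω ^ 2 ∂P - m ^ 2) / 2) = q ^ 2 / 2 * (∫ ω, Y ω ^ 2 ∂P - m ^ 2) by
    ring] at key4
  refine key4.congr' ?_
  filter_upwards [eventually_gt_atTop 0] with n hn
  have hn0 : (n : ℝ) ≠ 0 := by positivity
  have e : ∫ ω, Real.exp (q / n * (Y ω - m)) ∂P =
      Real.exp (-(q / n * m)) * ∫ ω, Real.exp (q / n * Y ω) ∂P := by
    rw [← integral_const_mul]
    congr 1
    ext ω
    rw [← Real.exp_add]
    ring_nf
  have e2 : Real.exp (-(q / n * m)) ^ n = Real.exp (-(q * m)) := by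
    rw [← Real.exp_nat_mul]
    congr 1
    field_simp
  rw [add_sub_cancel, e, mul_pow, e2, Real.exp_neg]
  have := (Real.exp_pos (q * m)).ne'
  field_simp

end ExponentialMoments

/-! ### Moments of the logarithm and of the argument -/

section LogMoments

variable {μ : ℝ} {σ : ℝ≥0}

/-- For real `α` the logarithm is singular at `x = -α`. Within distance `1` of `-Re α` the density
is bounded and `|x + Re α| ^ (-1/2)` is integrable; elsewhere the power is at most `1`. -/
lemma integrable_norm_add_rpow_neg_half (hσ : 0 < σ) (α : ℂ) :
    Integrable (fun x : ℝ => ‖(x : ℂ) + α‖ ^ (-(1 / 2) : ℝ)) (cauchyMeasure μ σ) := by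
  have hσ' : (0 : ℝ) < σ := by exact_mod_cast hσ
  have hloc : IntegrableOn (fun x : ℝ => |x| ^ (-(1 / 2) : ℝ)) (Set.Ioc (-1) 1) volume := by
    have h := (intervalIntegral.intervalIntegrable_cpow' (a := -1) (b := 1)
      (r := ((-(1 / 2) : ℝ) : ℂ)) (by rw [Complex.ofReal_re]; norm_num)).norm
    rw [intervalIntegrable_iff_integrableOn_Ioc_of_le (by norm_num)] at h
    refine h.congr_fun (fun x _ => ?_) measurableSet_Ioc
    simp only
    rw [Complex.norm_cpow_real, Complex.norm_real, Real.norm_eq_abs]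
  have hind := ((integrable_indicator_iff measurableSet_Ioc).2 hloc).comp_add_right α.re
  rw [integrable_cauchyMeasure_iff hσ]
  have hdom := (hind.const_mul (Real.pi⁻¹ * (σ : ℝ)⁻¹)).add (integrable_cauchyPDFReal μ (γ := σ))
  refine hdom.mono' (Measurable.aestronglyMeasurable (by fun_prop)) ?_
  filter_upwards [(Set.countable_singleton (-α.re)).ae_notMem volume] with x hx
  have hx0 : x + α.re ≠ 0 := fun h => hx (by simp; linarith)
  have hpdf := (cauchyPDF_pos μ hσ.ne' x).le
  have hpdf2 : cauchyPDFReal μ σ x ≤ Real.pi⁻¹ * (σ : ℝ)⁻¹ := by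
    rw [cauchyPDFReal_def']
    refine mul_le_of_le_one_right (by positivity) (inv_le_one_of_one_le₀ ?_)
    nlinarith [sq_nonneg ((x - μ) / σ)]
  have hre : |x + α.re| ≤ ‖(x : ℂ) + α‖ := by
    have := Complex.abs_re_le_norm ((x : ℂ) + α)
    simpa using this
  have habs : 0 < |x + α.re| := abs_pos.2 hx0
  have hmono : ‖(x : ℂ) + α‖ ^ (-(1 / 2) : ℝ) ≤ |x + α.re| ^ (-(1 / 2) : ℝ) :=
    Real.rpow_le_rpow_of_nonpos habs hre (by norm_num)
  have hnn : 0 ≤ ‖(x : ℂ) + α‖ ^ (-(1 / 2) : ℝ) := by positivity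
  simp only [smul_eq_mul, Pi.add_apply]
  rw [Real.norm_of_nonneg (mul_nonneg hpdf hnn)]
  by_cases hmem : x + α.re ∈ Set.Ioc (-1 : ℝ) 1
  · rw [Set.indicator_of_mem hmem]
    have : cauchyPDFReal μ σ x * ‖(x : ℂ) + α‖ ^ (-(1 / 2) : ℝ) ≤
        Real.pi⁻¹ * (σ : ℝ)⁻¹ * |x + α.re| ^ (-(1 / 2) : ℝ) := by gcongr
    linarith
  · rw [Set.indicator_of_notMem hmem, mul_zero, zero_add]
    have h1 : 1 ≤ |x + α.re| := by
      by_contra! hlt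
      exact hmem ⟨(abs_lt.1 hlt).1, (abs_lt.1 hlt).2.le⟩
    exact mul_le_of_le_one_right hpdf (Real.rpow_le_one_of_one_le_of_nonpos (h1.trans hre) (by norm_num))

lemma exp_half_norm_log_le {z : ℂ} (hz : z ≠ 0) :
    Real.exp (1 / 2 * ‖Complex.log z‖) ≤
      Real.exp (1 / 2 * Real.pi) * (‖z‖ ^ (1 / 2 : ℝ) + ‖z‖ ^ (-(1 / 2) : ℝ)) := by
  have hpos : 0 < ‖z‖ := norm_pos_iff.2 hz
  have h1 : ‖Complex.log z‖ ≤ |Real.log ‖z‖| + Real.pi := by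
    refine (Complex.norm_le_abs_re_add_abs_im _).trans ?_
    rw [Complex.log_re, Complex.log_im]
    gcongr
    exact Complex.abs_arg_le_pi z
  have h2 : Real.exp (1 / 2 * |Real.log ‖z‖|) ≤ ‖z‖ ^ (1 / 2 : ℝ) + ‖z‖ ^ (-(1 / 2) : ℝ) := by
    rw [Real.rpow_def_of_pos hpos, Real.rpow_def_of_pos hpos]
    rcases abs_cases (Real.log ‖z‖) with h | h
    · rw [h.1, mul_comm]
      linarith [Real.exp_pos (Real.log ‖z‖ * -(1 / 2))]
    · rw [h.1, show 1 / 2 * -Real.log ‖z‖ = Real.log ‖z‖ * -(1 / 2) by ring]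
      linarith [Real.exp_pos (Real.log ‖z‖ * (1 / 2))]
  calc Real.exp (1 / 2 * ‖Complex.log z‖)
      ≤ Real.exp (1 / 2 * Real.pi + 1 / 2 * |Real.log ‖z‖|) := by
        rw [Real.exp_le_exp]; linarith
    _ ≤ _ := by rw [Real.exp_add]; gcongr

/-- The moment of order `1/2` controls infinity, that of order `-1/2` controls the zero of `x + α`,
and the argument is bounded. This is the exponential moment hypothesis of the expansions, with `ε =
1/2`. -/
lemma integrable_exp_norm_log (hσ : 0 < σ) (α : ℂ) :
    Integrable (fun x : ℝ => Real.exp (1 / 2 * ‖Complex.log ((x : ℂ) + α)‖))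
      (cauchyMeasure μ σ) := by
  refine (((integrable_norm_add_rpow hσ α (by norm_num) (by norm_num : (1 / 2 : ℝ) < 1)).add
    (integrable_norm_add_rpow_neg_half hσ α)).const_mul (Real.exp (1 / 2 * Real.pi))).mono'
    (Measurable.aestronglyMeasurable (by fun_prop)) ?_
  filter_upwards [ae_add_ne_zero hσ α] with x hx
  rw [Real.norm_of_nonneg (Real.exp_pos _).le]
  exact exp_half_norm_log_le hx

lemma location_im_pos (hσ : 0 < σ) {α : ℂ} (hα : 0 ≤ α.im) :
    0 < ((μ : ℂ) + (σ : ℝ) * Complex.I + α).im := by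
  have hσ' : (0 : ℝ) < σ := by exact_mod_cast hσ
  simp
  linarith

lemma location_ne_zero (hσ : 0 < σ) {α : ℂ} (hα : 0 ≤ α.im) :
    (μ : ℂ) + (σ : ℝ) * Complex.I + α ≠ 0 := by
  intro h
  have := location_im_pos (μ := μ) hσ hα
  rw [h] at this
  simp at this

lemma aestronglyMeasurable_log_add (α : ℂ) (ν : Measure ℝ) :
    AEStronglyMeasurable (fun x : ℝ => Complex.log ((x : ℂ) + α)) ν :=
  Measurable.aestronglyMeasurable (by fun_prop)

/-- First and second moment of the logarithm of a shifted Cauchy variable. -/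
lemma integral_log_add (hσ : 0 < σ) {α : ℂ} (hα : 0 ≤ α.im) :
    ∫ x : ℝ, Complex.log ((x : ℂ) + α) ∂(cauchyMeasure μ σ) =
        Complex.log ((μ : ℂ) + (σ : ℝ) * Complex.I + α) ∧
      ∫ x : ℝ, Complex.log ((x : ℂ) + α) ^ 2 ∂(cauchyMeasure μ σ) =
        Complex.log ((μ : ℂ) + (σ : ℝ) * Complex.I + α) ^ 2 := by
  refine integral_eq_of_mgf_eq_exp one_half_pos (aestronglyMeasurable_log_add α _)
    (integrable_exp_norm_log hσ α) ?_
  filter_upwards [Ioo_mem_nhdsGT zero_lt_one] with s hs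
  have h := integral_add_cpow (μ := μ) hσ hα hs.1 hs.2
  rw [Complex.cpow_def_of_ne_zero (location_ne_zero hσ hα), mul_comm (Complex.log _)] at h
  rw [← h]
  refine integral_congr_ae ?_
  filter_upwards [ae_add_ne_zero hσ α] with x hx
  rw [Complex.cpow_def_of_ne_zero hx, mul_comm]

lemma integrable_log_add (hσ : 0 < σ) (α : ℂ) :
    Integrable (fun x : ℝ => Complex.log ((x : ℂ) + α)) (cauchyMeasure μ σ) :=
  integrable_of_exp one_half_pos (aestronglyMeasurable_log_add α _) (integrable_exp_norm_log hσ α)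

lemma integrable_exp_abs_log_norm (hσ : 0 < σ) (α : ℂ) :
    Integrable (fun x : ℝ => Real.exp (1 / 2 * |Real.log ‖(x : ℂ) + α‖|))
      (cauchyMeasure μ σ) := by
  refine (integrable_exp_norm_log hσ α).mono' (Measurable.aestronglyMeasurable (by fun_prop))
    (ae_of_all _ fun x => ?_)
  rw [Real.norm_of_nonneg (Real.exp_pos _).le, Real.exp_le_exp]
  gcongr
  rw [← Complex.log_re]
  exact Complex.abs_re_le_norm _

lemma integral_log_norm_add (hσ : 0 < σ) {α : ℂ} (hα : 0 ≤ α.im) :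
    ∫ x : ℝ, Real.log ‖(x : ℂ) + α‖ ∂(cauchyMeasure μ σ) =
      Real.log ‖(μ : ℂ) + (σ : ℝ) * Complex.I + α‖ := by
  have h := congrArg Complex.re (integral_log_add (μ := μ) hσ hα).1
  rw [Complex.log_re] at h
  rw [← h]
  simp only [← Complex.log_re]
  exact integral_re (integrable_log_add hσ α)

lemma integral_arg_add (hσ : 0 < σ) {α : ℂ} (hα : 0 ≤ α.im) :
    ∫ x : ℝ, ((x : ℂ) + α).arg ∂(cauchyMeasure μ σ) =
      ((μ : ℂ) + (σ : ℝ) * Complex.I + α).arg := by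
  have h := congrArg Complex.im (integral_log_add (μ := μ) hσ hα).1
  rw [Complex.log_im] at h
  rw [← h]
  simp only [← Complex.log_im]
  exact integral_im (integrable_log_add hσ α)

lemma integrable_arg_sq (hσ : 0 < σ) (α : ℂ) :
    Integrable (fun x : ℝ => ((x : ℂ) + α).arg ^ 2) (cauchyMeasure μ σ) := by
  refine (integrable_norm_sq_of_exp one_half_pos (aestronglyMeasurable_log_add α _)
    (integrable_exp_norm_log hσ α)).mono' (Measurable.aestronglyMeasurable (by fun_prop))
    (ae_of_all _ fun x => ?_)
  rw [← Complex.log_im, norm_pow, Real.norm_eq_abs]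
  gcongr
  exact Complex.abs_im_le_norm _

lemma integrable_log_norm_sq (hσ : 0 < σ) (α : ℂ) :
    Integrable (fun x : ℝ => Real.log ‖(x : ℂ) + α‖ ^ 2) (cauchyMeasure μ σ) := by
  refine (integrable_norm_sq_of_exp one_half_pos (aestronglyMeasurable_log_add α _)
    (integrable_exp_norm_log hσ α)).mono' (Measurable.aestronglyMeasurable (by fun_prop))
    (ae_of_all _ fun x => ?_)
  rw [← Complex.log_re, norm_pow, Real.norm_eq_abs]
  gcongr
  exact Complex.abs_re_le_norm _

/-- The real and the imaginary part of the logarithm have the same variance. -/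
lemma variance_log_norm_eq_variance_arg (hσ : 0 < σ) {α : ℂ} (hα : 0 ≤ α.im) :
    ∫ x : ℝ, Real.log ‖(x : ℂ) + α‖ ^ 2 ∂(cauchyMeasure μ σ) -
        Real.log ‖(μ : ℂ) + (σ : ℝ) * Complex.I + α‖ ^ 2 =
      ∫ x : ℝ, ((x : ℂ) + α).arg ^ 2 ∂(cauchyMeasure μ σ) -
        ((μ : ℂ) + (σ : ℝ) * Complex.I + α).arg ^ 2 := by
  -- The real part of `E L ^ 2 = l ^ 2` is the claim after rearrangement.
  have hre : ∀ z : ℂ, (Complex.log z ^ 2).re = Real.log ‖z‖ ^ 2 - z.arg ^ 2 := by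
    intro z
    rw [sq, Complex.mul_re, Complex.log_re, Complex.log_im]
    ring
  have h := congrArg Complex.re (integral_log_add (μ := μ) hσ hα).2
  have h2 := integral_re (integrable_sq_of_exp one_half_pos (aestronglyMeasurable_log_add α _)
    (integrable_exp_norm_log (μ := μ) hσ α))
  simp only [RCLike.re_eq_complex_re] at h2
  rw [← h2, hre] at h
  simp only [hre] at h
  rw [integral_sub (integrable_log_norm_sq hσ α) (integrable_arg_sq hσ α)] at h
  linarith

lemma angle_eq_arg {z : ℂ} (hz : z ≠ 0) (him : 0 ≤ z.im) : angle z.re z.im = z.arg := by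
  rw [Complex.arg_of_im_nonneg_of_ne_zero him hz, angle, Complex.norm_eq_sqrt_sq_add_sq]

lemma angle_location (hσ : 0 < σ) {α : ℂ} (hα : 0 ≤ α.im) :
    angle (μ + α.re) (σ + α.im) = ((μ : ℂ) + (σ : ℝ) * Complex.I + α).arg := by
  have h := angle_eq_arg (location_ne_zero (μ := μ) hσ hα) (location_im_pos hσ hα).le
  simpa using h

/-- Equality can fail at `x = -Re α` when `α` is real: there `angle 0 0 = arccos 0 = π / 2` because
`0 / 0 = 0`, while `Complex.arg 0 = 0`. -/
lemma ae_cauchyPDF_mul_arg_sq_eq {α : ℂ} (hα : 0 ≤ α.im) :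
    (fun x : ℝ => (σ : ℝ) / Real.pi * (angle (x + α.re) α.im ^ 2 /
      ((x + α.re - (α.re + μ)) ^ 2 + (σ : ℝ) ^ 2))) =ᵐ[volume]
      fun x : ℝ => cauchyPDFReal μ σ x • ((x : ℂ) + α).arg ^ 2 := by
  filter_upwards [(Set.countable_singleton (-α.re)).ae_notMem volume] with x hx
  have hne : (x : ℂ) + α ≠ 0 := by
    intro h
    have := congrArg Complex.re h
    simp at this
    exact hx (by simp; linarith)
  have h := angle_eq_arg hne (by simpa using hα)
  simp only [Complex.add_re, Complex.ofReal_re, Complex.add_im, Complex.ofReal_im, zero_add] at h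
  rw [h, cauchyPDFReal_def, smul_eq_mul]
  ring

lemma integrable_angle_sq_div (hσ : 0 < σ) {α : ℂ} (hα : 0 ≤ α.im) :
    Integrable (fun x : ℝ => angle x α.im ^ 2 / ((x - (α.re + μ)) ^ 2 + (σ : ℝ) ^ 2)) volume := by
  have hσ' : (0 : ℝ) < σ := by exact_mod_cast hσ
  have h := ((integrable_cauchyMeasure_iff hσ).1 (integrable_arg_sq (μ := μ) hσ α)).congr
    (ae_cauchyPDF_mul_arg_sq_eq hα).symm
  have h2 := (h.comp_sub_right α.re).const_mul (Real.pi / σ)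
  refine h2.congr (ae_of_all _ fun x => ?_)
  simp only [sub_add_cancel]
  have := Real.pi_pos.ne'
  field_simp

lemma integral_angle_sq_div (hσ : 0 < σ) {α : ℂ} (hα : 0 ≤ α.im) :
    (σ : ℝ) / Real.pi *
        (∫ x : ℝ, angle x α.im ^ 2 / ((x - (α.re + μ)) ^ 2 + (σ : ℝ) ^ 2)) =
      ∫ x : ℝ, ((x : ℂ) + α).arg ^ 2 ∂(cauchyMeasure μ σ) := by
  rw [integral_cauchyMeasure hσ, ← integral_congr_ae (ae_cauchyPDF_mul_arg_sq_eq hα),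
    integral_const_mul, integral_add_right_eq_self
      (fun x : ℝ => angle x α.im ^ 2 / ((x - (α.re + μ)) ^ 2 + (σ : ℝ) ^ 2))]

/-- On the real line `arg` is `0` or `π`, so `arg ^ 2 = π * arg` pointwise. -/
lemma integral_arg_sq_of_real (hσ : 0 < σ) :
    ∫ x : ℝ, (x : ℂ).arg ^ 2 ∂(cauchyMeasure μ σ) =
      Real.pi * ((μ : ℂ) + (σ : ℝ) * Complex.I).arg := by
  have h := integral_arg_add (μ := μ) (α := 0) hσ le_rfl
  simp only [add_zero] at h
  rw [← h, ← integral_const_mul]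
  congr 1
  ext x
  rcases le_or_gt 0 x with hx | hx
  · rw [Complex.arg_ofReal_of_nonneg hx]; simp
  · rw [Complex.arg_ofReal_of_neg hx]; ring

end LogMoments

/-! ### The estimator: mean, variance and almost sure limit -/

section Estimator

lemma integrable_prod_comp {Ω 𝓧 𝕜 : Type*} [MeasurableSpace Ω] [MeasurableSpace 𝓧] [RCLike 𝕜]
    {P : Measure Ω} {ν : Measure 𝓧} [IsProbabilityMeasure ν] {X : ℕ → Ω → 𝓧}
    (hlaw : ∀ i, HasLaw (X i) ν P) (hindep : iIndepFun X P) {f : 𝓧 → 𝕜} (hf : Integrable f ν)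
    (n : ℕ) : Integrable (fun ω => ∏ j ∈ Finset.range n, f (X j ω)) P := by
  have hpi : HasLaw (fun ω (i : Fin n) => X i ω) (Measure.pi fun _ => ν) P :=
    iIndepFun.hasLaw_pi (X := fun (i : Fin n) ω => X i ω) (fun i => hlaw i)
      (hindep.precomp Fin.val_injective)
  have hg : Integrable (fun y : Fin n → 𝓧 => ∏ i, f (y i)) (Measure.pi fun _ => ν) :=
    Integrable.fintype_prod fun _ => hf
  rw [← hpi.map_eq] at hg
  simp only [Finset.prod_range]
  exact hg.comp_aemeasurable hpi.aemeasurable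

lemma integral_prod_comp {Ω 𝓧 𝕜 : Type*} [MeasurableSpace Ω] [MeasurableSpace 𝓧] [RCLike 𝕜]
    {P : Measure Ω} {ν : Measure 𝓧} {X : ℕ → Ω → 𝓧}
    (hlaw : ∀ i, HasLaw (X i) ν P) (hindep : iIndepFun X P) {f : 𝓧 → 𝕜}
    (hf : AEStronglyMeasurable f ν) (n : ℕ) :
    ∫ ω, ∏ j ∈ Finset.range n, f (X j ω) ∂P = (∫ x, f x ∂ν) ^ n := by
  have h := (hindep.precomp (g := fun i : Fin n => (i : ℕ)) Fin.val_injective).integral_fun_prod_comp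
    (f := fun _ => f) (fun i => (hlaw i).aemeasurable) (fun i => by rwa [(hlaw i).map_eq])
  simp only [Finset.prod_range]
  rw [h]
  have h2 : ∀ i, ∫ ω, f (X i ω) ∂P = ∫ x, f x ∂ν := fun i => (hlaw i).integral_comp hf
  simp [h2]

/-- The two branches differ only in the open third quadrant. At `z = 0` the condition `p ≠ 0`
matters, since `0 ^ 0 = 1` for `cpow`. -/
lemma powBranch_eq_cpow {z : ℂ} (hz : 0 ≤ z.im) {p : ℝ} (hp : p ≠ 0) :
    powBranch z p = z ^ (p : ℂ) := by
  by_cases h : z = 0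
  · rw [powBranch, if_pos h, h, Complex.zero_cpow (by exact_mod_cast hp)]
  · have harg : argBranch z = z.arg := by
      rw [argBranch, if_neg]
      have := Complex.arg_nonneg_iff.2 hz
      linarith [Real.pi_pos]
    rw [powBranch, if_neg h, Complex.cpow_def_of_ne_zero h, logBranch, harg, mul_comm]
    rfl

lemma geomMean_add {α : ℂ} (hα : 0 ≤ α.im) {n : ℕ} (hn : 0 < n) (x : ℕ → ℝ) :
    geomMean α n x + α = ∏ j ∈ Finset.range n, ((x j : ℂ) + α) ^ ((1 / n : ℝ) : ℂ) := by
  rw [geomMean, sub_add_cancel]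
  refine Finset.prod_congr rfl fun j _ => powBranch_eq_cpow (by simpa using hα) ?_
  have : (0 : ℝ) < n := by exact_mod_cast hn
  positivity

lemma norm_geomMean_add_pow {α : ℂ} (hα : 0 ≤ α.im) {n : ℕ} (hn : 0 < n) (x : ℕ → ℝ) (k : ℕ) :
    ‖geomMean α n x + α‖ ^ k = ∏ j ∈ Finset.range n, ‖(x j : ℂ) + α‖ ^ (k / n : ℝ) := by
  rw [geomMean_add hα hn, norm_prod, ← Finset.prod_pow]
  refine Finset.prod_congr rfl fun j _ => ?_
  rw [Complex.norm_cpow_real, ← Real.rpow_natCast, ← Real.rpow_mul (norm_nonneg _)]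
  congr 1
  ring

variable {Ω : Type*} [MeasurableSpace Ω] {P : Measure Ω} {μ : ℝ} {σ : ℝ≥0} {X : ℕ → Ω → ℝ} {α : ℂ}

lemma integrable_add_cpow (hσ : 0 < σ) (α : ℂ) {p : ℝ} (hp0 : 0 ≤ p) (hp : p < 1) :
    Integrable (fun x : ℝ => ((x : ℂ) + α) ^ (p : ℂ)) (cauchyMeasure μ σ) :=
  (integrable_norm_add_rpow hσ α hp0 hp).mono' (Measurable.aestronglyMeasurable (by fun_prop))
    (ae_of_all _ fun x => by rw [Complex.norm_cpow_real])

lemma integrable_geomMean_add (hσ : 0 < σ) (hlaw : ∀ i, HasLaw (X i) (cauchyMeasure μ σ) P)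
    (hindep : iIndepFun X P) (hα : 0 ≤ α.im) {n : ℕ} (hn : 2 ≤ n) :
    Integrable (fun ω => geomMean α n (fun j => X j ω) + α) P := by
  have hn' : (2 : ℝ) ≤ n := by exact_mod_cast hn
  simp only [geomMean_add hα (by omega : 0 < n)]
  refine integrable_prod_comp hlaw hindep (f := fun x : ℝ => ((x : ℂ) + α) ^ ((1 / n : ℝ) : ℂ))
    (integrable_add_cpow hσ α (by positivity) ?_) n
  rw [div_lt_one (by linarith)]
  linarith

lemma integral_geomMean_add (hσ : 0 < σ) (hlaw : ∀ i, HasLaw (X i) (cauchyMeasure μ σ) P)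
    (hindep : iIndepFun X P) (hα : 0 ≤ α.im) {n : ℕ} (hn : 2 ≤ n) :
    ∫ ω, (geomMean α n (fun j => X j ω) + α) ∂P = (μ : ℂ) + (σ : ℝ) * Complex.I + α := by
  have hn' : (2 : ℝ) ≤ n := by exact_mod_cast hn
  simp only [geomMean_add hα (by omega : 0 < n)]
  rw [integral_prod_comp hlaw hindep (f := fun x : ℝ => ((x : ℂ) + α) ^ ((1 / n : ℝ) : ℂ))
    (Measurable.aestronglyMeasurable (by fun_prop)) n, integral_add_cpow hσ hα (by positivity)
    (by rw [div_lt_one (by linarith)]; linarith)]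
  rw [Complex.ofReal_div, Complex.ofReal_one, one_div, Complex.ofReal_natCast,
    Complex.cpow_nat_inv_pow _ (by omega)]

/-- Each factor carries the exponent `k / n`, and `k < n` keeps it below `1`, where Cauchy moments
are finite. -/
lemma integrable_norm_geomMean_add_pow (hσ : 0 < σ)
    (hlaw : ∀ i, HasLaw (X i) (cauchyMeasure μ σ) P) (hindep : iIndepFun X P) (hα : 0 ≤ α.im)
    {k n : ℕ} (hkn : k < n) :
    Integrable (fun ω => ‖geomMean α n (fun j => X j ω) + α‖ ^ k) P := by
  have hn : (0 : ℝ) < n := by exact_mod_cast (Nat.zero_le k).trans_lt hkn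
  simp only [norm_geomMean_add_pow hα ((Nat.zero_le k).trans_lt hkn)]
  refine integrable_prod_comp hlaw hindep (f := fun x : ℝ => ‖(x : ℂ) + α‖ ^ (k / n : ℝ))
    (integrable_norm_add_rpow hσ α (by positivity) ?_) n
  rw [div_lt_one hn]
  exact_mod_cast hkn

lemma integral_norm_geomMean_add_pow (hσ : 0 < σ)
    (hlaw : ∀ i, HasLaw (X i) (cauchyMeasure μ σ) P) (hindep : iIndepFun X P) (hα : 0 ≤ α.im)
    (k : ℕ) {n : ℕ} (hn : 0 < n) :
    ∫ ω, ‖geomMean α n (fun j => X j ω) + α‖ ^ k ∂P =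
      (∫ x : ℝ, Real.exp (k / n * Real.log ‖(x : ℂ) + α‖) ∂(cauchyMeasure μ σ)) ^ n := by
  simp only [norm_geomMean_add_pow hα hn]
  rw [integral_prod_comp hlaw hindep (f := fun x : ℝ => ‖(x : ℂ) + α‖ ^ (k / n : ℝ))
    (Measurable.aestronglyMeasurable (by fun_prop)) n]
  congr 1
  refine integral_congr_ae ?_
  filter_upwards [ae_add_ne_zero hσ α] with x hx
  rw [Real.rpow_def_of_pos (norm_pos_iff.2 hx), mul_comm]

lemma aestronglyMeasurable_geomMean (hX : ∀ i, AEMeasurable (X i) P) (hα : 0 ≤ α.im) (n : ℕ) :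
    AEStronglyMeasurable (fun ω => geomMean α n (fun j => X j ω)) P := by
  rcases Nat.eq_zero_or_pos n with rfl | hn
  · simpa [geomMean] using aestronglyMeasurable_const
  · have h : ∀ ω, geomMean α n (fun j => X j ω) =
        (∏ j ∈ Finset.range n, ((X j ω : ℂ) + α) ^ ((1 / n : ℝ) : ℂ)) - α := fun ω => by
      rw [← geomMean_add hα hn, add_sub_cancel_right]
    simp only [h]
    refine AEMeasurable.aestronglyMeasurable ?_
    fun_prop

/-- The scaled error of the absolute moments of the shifted geometric mean. -/
lemma tendsto_mul_integral_norm_pow_sub (hσ : 0 < σ)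
    (hlaw : ∀ i, HasLaw (X i) (cauchyMeasure μ σ) P) (hindep : iIndepFun X P) (hα : 0 ≤ α.im)
    {k : ℕ} (hk : 0 < k) :
    Tendsto (fun n : ℕ => (n : ℝ) * (∫ ω, ‖geomMean α n (fun j => X j ω) + α‖ ^ k ∂P -
        ‖(μ : ℂ) + (σ : ℝ) * Complex.I + α‖ ^ k)) atTop
      (𝓝 (‖(μ : ℂ) + (σ : ℝ) * Complex.I + α‖ ^ k * ((k : ℝ) ^ 2 / 2 *
        (∫ x : ℝ, ((x : ℂ) + α).arg ^ 2 ∂(cauchyMeasure μ σ) -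
          ((μ : ℂ) + (σ : ℝ) * Complex.I + α).arg ^ 2)))) := by
  have h := tendsto_mul_mgf_pow_sub one_half_pos
    (Measurable.aestronglyMeasurable (by fun_prop))
    (integrable_exp_abs_log_norm hσ α) (integral_log_norm_add (μ := μ) hσ hα)
    (q := k) (by exact_mod_cast hk)
  rw [variance_log_norm_eq_variance_arg hσ hα, Real.exp_nat_mul,
    Real.exp_log (norm_pos_iff.2 (location_ne_zero hσ hα))] at h
  refine h.congr' ?_
  filter_upwards [eventually_gt_atTop 0] with n hn
  rw [integral_norm_geomMean_add_pow hσ hlaw hindep hα k hn]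

lemma integral_norm_sub_sq [IsProbabilityMeasure P] {W : Ω → ℂ} (hW : Integrable W P)
    (hW2 : Integrable (fun ω => ‖W ω‖ ^ 2) P) {w : ℂ} (hw : ∫ ω, W ω ∂P = w) :
    ∫ ω, ‖W ω - w‖ ^ 2 ∂P = ∫ ω, ‖W ω‖ ^ 2 ∂P - ‖w‖ ^ 2 := by
  have e : ∀ ω, ‖W ω - w‖ ^ 2 = ‖W ω‖ ^ 2 - 2 * (W ω * (starRingEnd ℂ) w).re + ‖w‖ ^ 2 := by
    intro ω
    simp only [← Complex.normSq_eq_norm_sq]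
    rw [Complex.normSq_sub]
    ring
  have hi : Integrable (fun ω => (W ω * (starRingEnd ℂ) w).re) P :=
    (hW.mul_const ((starRingEnd ℂ) w)).re
  have hi2 : Integrable (fun ω => ‖W ω‖ ^ 2 - 2 * (W ω * (starRingEnd ℂ) w).re) P :=
    hW2.sub (hi.const_mul 2)
  have hre : ∫ ω, (W ω * (starRingEnd ℂ) w).re ∂P = ‖w‖ ^ 2 := by
    have h := integral_re (hW.mul_const ((starRingEnd ℂ) w))
    simp only [RCLike.re_eq_complex_re] at h
    rw [h, integral_mul_const, hw, Complex.mul_conj, Complex.ofReal_re, Complex.normSq_eq_norm_sq]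
  simp_rw [e]
  rw [integral_add hi2 (integrable_const _), integral_sub hW2 (hi.const_mul 2),
    integral_const_mul, hre]
  simp
  ring

lemma integral_geomMean [IsProbabilityMeasure P] (hσ : 0 < σ)
    (hlaw : ∀ i, HasLaw (X i) (cauchyMeasure μ σ) P)
    (hindep : iIndepFun X P) (hα : 0 ≤ α.im) {n : ℕ} (hn : 2 ≤ n) :
    Integrable (fun ω => geomMean α n (fun j => X j ω)) P ∧
      ∫ ω, geomMean α n (fun j => X j ω) ∂P = (μ : ℂ) + (σ : ℝ) * Complex.I := by
  have h1 := integrable_geomMean_add hσ hlaw hindep hα hn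
  have h2 := integral_geomMean_add hσ hlaw hindep hα hn
  have h3 : Integrable (fun ω => geomMean α n (fun j => X j ω)) P := by
    refine (h1.sub (integrable_const α)).congr (ae_of_all _ fun ω => ?_)
    simp
  refine ⟨h3, ?_⟩
  rw [integral_add h3 (integrable_const α)] at h2
  simpa using h2

lemma integral_norm_geomMean_sub_sq [IsProbabilityMeasure P] (hσ : 0 < σ)
    (hlaw : ∀ i, HasLaw (X i) (cauchyMeasure μ σ) P) (hindep : iIndepFun X P) (hα : 0 ≤ α.im)
    {n : ℕ} (hn : 3 ≤ n) :
    ∫ ω, ‖geomMean α n (fun j => X j ω) - ((μ : ℂ) + (σ : ℝ) * Complex.I)‖ ^ 2 ∂P =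
      ∫ ω, ‖geomMean α n (fun j => X j ω) + α‖ ^ 2 ∂P -
        ‖(μ : ℂ) + (σ : ℝ) * Complex.I + α‖ ^ 2 := by
  rw [← integral_norm_sub_sq (integrable_geomMean_add hσ hlaw hindep hα (by omega))
    (integrable_norm_geomMean_add_pow hσ hlaw hindep hα (by omega))
    (integral_geomMean_add hσ hlaw hindep hα (by omega))]
  congr 1
  ext ω
  congr 2
  ring

lemma tendsto_mul_cvar_geomMean [IsProbabilityMeasure P] (hσ : 0 < σ)
    (hlaw : ∀ i, HasLaw (X i) (cauchyMeasure μ σ) P) (hindep : iIndepFun X P) (hα : 0 ≤ α.im) :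
    Tendsto (fun n : ℕ => (n : ℝ) * cvar (fun ω => geomMean α n (fun j => X j ω)) P) atTop
      (𝓝 (2 * ‖(μ : ℂ) + (σ : ℝ) * Complex.I + α‖ ^ 2 *
        (∫ x : ℝ, ((x : ℂ) + α).arg ^ 2 ∂(cauchyMeasure μ σ) -
          ((μ : ℂ) + (σ : ℝ) * Complex.I + α).arg ^ 2))) := by
  have h := tendsto_mul_integral_norm_pow_sub hσ hlaw hindep hα two_pos
  have e : ∀ a b : ℝ, a ^ 2 * (((2 : ℕ) : ℝ) ^ 2 / 2 * b) = 2 * a ^ 2 * b := fun a b => by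
    push_cast; ring
  rw [e] at h
  refine h.congr' ?_
  filter_upwards [eventually_ge_atTop 3] with n hn
  rw [cvar, (integral_geomMean hσ hlaw hindep hα (by omega)).2,
    integral_norm_geomMean_sub_sq hσ hlaw hindep hα hn]

/-- The strong law applies to `log (X_j + α)`, and the exponential is continuous and undoes the
logarithm of the limit. -/
lemma ae_tendsto_geomMean (hσ : 0 < σ)
    (hlaw : ∀ i, HasLaw (X i) (cauchyMeasure μ σ) P) (hindep : iIndepFun X P) (hα : 0 ≤ α.im) :
    ∀ᵐ ω ∂P, Tendsto (fun n : ℕ => geomMean α n (fun j => X j ω)) atTop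
      (𝓝 ((μ : ℂ) + (σ : ℝ) * Complex.I)) := by
  have hm : Measurable fun x : ℝ => Complex.log ((x : ℂ) + α) := by fun_prop
  have hident : ∀ i, IdentDistrib (X i) (X 0) P P := fun i =>
    ⟨(hlaw i).aemeasurable, (hlaw 0).aemeasurable, by rw [(hlaw i).map_eq, (hlaw 0).map_eq]⟩
  have hint : Integrable (fun ω => Complex.log ((X 0 ω : ℂ) + α)) P := by
    have h := integrable_log_add (μ := μ) hσ α
    rw [← (hlaw 0).map_eq] at h
    exact h.comp_aemeasurable (hlaw 0).aemeasurable
  have hslln := strong_law_ae (fun i ω => Complex.log ((X i ω : ℂ) + α)) hint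
    (fun i j hij => (hindep.indepFun hij).comp hm hm) (fun i => (hident i).comp hm)
  have hmean : ∫ ω, Complex.log ((X 0 ω : ℂ) + α) ∂P =
      Complex.log ((μ : ℂ) + (σ : ℝ) * Complex.I + α) := by
    rw [← (integral_log_add hσ hα).1]
    exact (hlaw 0).integral_comp hm.aestronglyMeasurable
  have hne : ∀ᵐ ω ∂P, ∀ i, (X i ω : ℂ) + α ≠ 0 := by
    rw [ae_all_iff]
    intro i
    have h := ae_add_ne_zero (μ := μ) hσ α
    rw [← (hlaw i).map_eq] at h
    exact ae_of_ae_map (hlaw i).aemeasurable h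
  filter_upwards [hslln, hne] with ω hω hωne
  rw [hmean] at hω
  have hexp := ((Complex.continuous_exp.tendsto _).comp hω).sub_const α
  rw [Complex.exp_log (location_ne_zero hσ hα), add_sub_cancel_right] at hexp
  refine hexp.congr' ?_
  filter_upwards [eventually_gt_atTop 0] with n hn
  rw [eq_comm, ← add_sub_cancel_right (geomMean α n _) α, geomMean_add hα hn]
  congr 1
  simp only [Function.comp]
  rw [Complex.real_smul, Finset.mul_sum, Complex.exp_sum]
  refine Finset.prod_congr rfl fun j _ => ?_
  rw [Complex.cpow_def_of_ne_zero (hωne j), mul_comm, one_div]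

end Estimator

/-! ### Convergence in `L^p` -/

section LpConvergence

variable {Ω : Type*} [MeasurableSpace Ω] {P : Measure Ω} {μ : ℝ} {σ : ℝ≥0} {X : ℕ → Ω → ℝ} {α : ℂ}

lemma norm_sub_pow_le_shifted (w α y : ℂ) (k : ℕ) :
    ‖y - w‖ ^ k ≤ 2 ^ (k - 1) * (‖y + α‖ ^ k + ‖w + α‖ ^ k) := by
  refine le_trans ?_ (add_pow_le (norm_nonneg _) (norm_nonneg _) k)
  gcongr
  refine le_trans (le_of_eq ?_) (norm_sub_le _ _)
  congr 1
  ring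

lemma integrable_norm_geomMean_sub_pow [IsProbabilityMeasure P] (hσ : 0 < σ)
    (hlaw : ∀ i, HasLaw (X i) (cauchyMeasure μ σ) P) (hindep : iIndepFun X P) (hα : 0 ≤ α.im)
    {k n : ℕ} (hkn : k < n) :
    Integrable (fun ω => ‖geomMean α n (fun j => X j ω) - ((μ : ℂ) + (σ : ℝ) * Complex.I)‖ ^ k)
      P := by
  have hm := aestronglyMeasurable_geomMean (fun i => (hlaw i).aemeasurable) hα n
  refine (((integrable_norm_geomMean_add_pow hσ hlaw hindep hα hkn).add
    (integrable_const (‖(μ : ℂ) + (σ : ℝ) * Complex.I + α‖ ^ k))).const_mul (2 ^ (k - 1))).mono'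
    (by fun_prop) (ae_of_all _ fun ω => ?_)
  rw [Real.norm_of_nonneg (by positivity)]
  exact norm_sub_pow_le_shifted _ _ _ k

lemma tendsto_integral_norm_geomMean_add_pow (hσ : 0 < σ)
    (hlaw : ∀ i, HasLaw (X i) (cauchyMeasure μ σ) P) (hindep : iIndepFun X P) (hα : 0 ≤ α.im)
    {k : ℕ} (hk : 0 < k) :
    Tendsto (fun n : ℕ => ∫ ω, ‖geomMean α n (fun j => X j ω) + α‖ ^ k ∂P) atTop
      (𝓝 (‖(μ : ℂ) + (σ : ℝ) * Complex.I + α‖ ^ k)) := by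
  have h := (tendsto_inv_atTop_nhds_zero_nat (𝕜 := ℝ)).mul
    (tendsto_mul_integral_norm_pow_sub hσ hlaw hindep hα hk)
  rw [zero_mul] at h
  refine tendsto_sub_nhds_zero_iff.1 (h.congr' ?_)
  filter_upwards [eventually_gt_atTop 0] with n hn
  have : (n : ℝ) ≠ 0 := by positivity
  field_simp

lemma tendsto_integral_norm_geomMean_sub_pow [IsProbabilityMeasure P] (hσ : 0 < σ)
    (hlaw : ∀ i, HasLaw (X i) (cauchyMeasure μ σ) P) (hindep : iIndepFun X P) (hα : 0 ≤ α.im)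
    (k : ℕ) :
    Tendsto (fun n : ℕ => ∫ ω, ‖geomMean α n (fun j => X j ω) -
      ((μ : ℂ) + (σ : ℝ) * Complex.I)‖ ^ (k + 2) ∂P) atTop (𝓝 0) := by
  set w : ℂ := (μ : ℂ) + (σ : ℝ) * Complex.I with hw
  set m := 2 * (k + 1) with hm
  have hsqrt : Tendsto (fun n : ℕ => (√(n : ℝ))⁻¹) atTop (𝓝 0) :=
    tendsto_inv_atTop_zero.comp (Real.tendsto_sqrt_atTop.comp tendsto_natCast_atTop_atTop)
  have hvar := tendsto_mul_cvar_geomMean hσ hlaw hindep hα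
  have hmom := ((tendsto_integral_norm_geomMean_add_pow hσ hlaw hindep hα
    (by omega : 0 < m)).add_const (‖w + α‖ ^ m)).const_mul (2 ^ (m - 1))
  have hbound := hsqrt.mul (hvar.add hmom)
  rw [zero_mul] at hbound
  refine squeeze_zero' (Eventually.of_forall fun n => integral_nonneg fun ω => by positivity)
    ?_ hbound
  filter_upwards [eventually_gt_atTop (m + 2)] with n hn
  have hn0 : (0 : ℝ) < n := by exact_mod_cast (by omega : 0 < n)
  have hs : 0 < √(n : ℝ) := Real.sqrt_pos.2 hn0
  have hi := fun j (hj : j < n) => integrable_norm_geomMean_sub_pow hσ hlaw hindep hα hj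
  have hi2 := integrable_norm_geomMean_add_pow hσ hlaw hindep hα (by omega : m < n)
  -- Weighted arithmetic-geometric mean inequality for `t ^ (k + 2) = t * t ^ (k + 1)`. The weight
  -- `√n` is beaten by the second moment, of order `1 / n`, and `1 / √n` beats the bounded moment of
  -- order `m`.
  have hpt : ∀ t : ℝ, 0 ≤ t → t ^ (k + 2) ≤ √(n : ℝ) * t ^ 2 + (√(n : ℝ))⁻¹ * t ^ m := by
    intro t ht
    have h1 : 0 ≤ (√(n : ℝ))⁻¹ * (√(n : ℝ) * t - t ^ (k + 1)) ^ 2 := by positivity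
    have h2 : (√(n : ℝ))⁻¹ * (√(n : ℝ) * t - t ^ (k + 1)) ^ 2 =
        √(n : ℝ) * t ^ 2 + (√(n : ℝ))⁻¹ * t ^ m - 2 * t ^ (k + 2) := by
      rw [hm]
      field_simp
      ring
    have h3 : 0 ≤ t ^ (k + 2) := by positivity
    linarith
  have hcv : cvar (fun ω => geomMean α n (fun j => X j ω)) P =
      ∫ ω, ‖geomMean α n (fun j => X j ω) - w‖ ^ 2 ∂P := by
    rw [cvar, (integral_geomMean hσ hlaw hindep hα (by omega)).2]
  have hm2 : ∫ ω, ‖geomMean α n (fun j => X j ω) - w‖ ^ m ∂P ≤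
      2 ^ (m - 1) * (∫ ω, ‖geomMean α n (fun j => X j ω) + α‖ ^ m ∂P + ‖w + α‖ ^ m) := by
    have : ∫ ω, 2 ^ (m - 1) * (‖geomMean α n (fun j => X j ω) + α‖ ^ m + ‖w + α‖ ^ m) ∂P =
        2 ^ (m - 1) * (∫ ω, ‖geomMean α n (fun j => X j ω) + α‖ ^ m ∂P + ‖w + α‖ ^ m) := by
      rw [integral_const_mul, integral_add hi2 (integrable_const _)]
      simp
    rw [← this]
    exact integral_mono (hi m (by omega)) ((hi2.add (integrable_const _)).const_mul _)
      fun ω => norm_sub_pow_le_shifted _ _ _ m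
  calc ∫ ω, ‖geomMean α n (fun j => X j ω) - w‖ ^ (k + 2) ∂P
      ≤ ∫ ω, (√(n : ℝ) * ‖geomMean α n (fun j => X j ω) - w‖ ^ 2 +
          (√(n : ℝ))⁻¹ * ‖geomMean α n (fun j => X j ω) - w‖ ^ m) ∂P :=
        integral_mono (hi _ (by omega))
          (((hi 2 (by omega)).const_mul _).add ((hi m (by omega)).const_mul _))
          fun ω => hpt _ (norm_nonneg _)
    _ = √(n : ℝ) * (∫ ω, ‖geomMean α n (fun j => X j ω) - w‖ ^ 2 ∂P) +
          (√(n : ℝ))⁻¹ * ∫ ω, ‖geomMean α n (fun j => X j ω) - w‖ ^ m ∂P := by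
        rw [integral_add ((hi 2 (by omega)).const_mul _) ((hi m (by omega)).const_mul _),
          integral_const_mul, integral_const_mul]
    _ ≤ √(n : ℝ) * (∫ ω, ‖geomMean α n (fun j => X j ω) - w‖ ^ 2 ∂P) +
          (√(n : ℝ))⁻¹ * (2 ^ (m - 1) *
            (∫ ω, ‖geomMean α n (fun j => X j ω) + α‖ ^ m ∂P + ‖w + α‖ ^ m)) := by gcongr
    _ = _ := by
        have hdiv : (√(n : ℝ))⁻¹ * n = √(n : ℝ) := by
          rw [inv_mul_eq_div, Real.div_sqrt]
        rw [hcv, mul_add (√(n : ℝ))⁻¹, ← mul_assoc (√(n : ℝ))⁻¹ (n : ℝ), hdiv]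

lemma memLp_geomMean_sub [IsProbabilityMeasure P] (hσ : 0 < σ)
    (hlaw : ∀ i, HasLaw (X i) (cauchyMeasure μ σ) P) (hindep : iIndepFun X P) (hα : 0 ≤ α.im)
    {k n : ℕ} (hk : 0 < k) (hkn : k < n) :
    MemLp (fun ω => geomMean α n (fun j => X j ω) - ((μ : ℂ) + (σ : ℝ) * Complex.I)) k P := by
  have hm := aestronglyMeasurable_geomMean (fun i => (hlaw i).aemeasurable) hα n
  rw [← integrable_norm_rpow_iff (by fun_prop) (by exact_mod_cast hk.ne')
    (ENNReal.natCast_ne_top k)]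
  simpa using integrable_norm_geomMean_sub_pow hσ hlaw hindep hα hkn

/-- On a probability space `L^p` norms increase with `p`, so an integer exponent `k + 2 ≥ p`
suffices. -/
lemma tendsto_eLpNorm_geomMean_sub [IsProbabilityMeasure P] (hσ : 0 < σ)
    (hlaw : ∀ i, HasLaw (X i) (cauchyMeasure μ σ) P) (hindep : iIndepFun X P) (hα : 0 ≤ α.im)
    {p : ℝ≥0∞} (hp : p < ∞) :
    (∀ᶠ n : ℕ in atTop, MemLp (fun ω => geomMean α n (fun j => X j ω)) p P) ∧
      Tendsto (fun n : ℕ => eLpNorm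
        (fun ω => geomMean α n (fun j => X j ω) - ((μ : ℂ) + (σ : ℝ) * Complex.I)) p P)
        atTop (𝓝 0) := by
  obtain ⟨k, hk⟩ : ∃ k : ℕ, p ≤ ((k + 2 : ℕ) : ℝ≥0∞) := by
    obtain ⟨k, hk⟩ := ENNReal.exists_nat_gt hp.ne
    exact ⟨k, hk.le.trans (by exact_mod_cast (by omega))⟩
  have hmem := fun {n : ℕ} (hn : k + 2 < n) =>
    memLp_geomMean_sub hσ hlaw hindep hα (by omega : 0 < k + 2) hn
  constructor
  · filter_upwards [eventually_gt_atTop (k + 2)] with n hn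
    have h := ((hmem hn).mono_exponent hk).add (memLp_const ((μ : ℂ) + (σ : ℝ) * Complex.I))
    convert h using 1
    ext ω
    simp
  · have hint := (tendsto_integral_norm_geomMean_sub_pow hσ hlaw hindep hα k).rpow_const
      (p := ((k + 2 : ℕ) : ℝ)⁻¹) (Or.inr (by positivity))
    rw [Real.zero_rpow (by positivity)] at hint
    have h2 := ENNReal.tendsto_ofReal hint
    rw [ENNReal.ofReal_zero] at h2
    refine tendsto_of_tendsto_of_tendsto_of_le_of_le' tendsto_const_nhds h2
      (Eventually.of_forall fun _ => zero_le) ?_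
    filter_upwards [eventually_gt_atTop (k + 2)] with n hn
    refine (eLpNorm_le_eLpNorm_of_exponent_le hk (hmem hn).aestronglyMeasurable).trans ?_
    rw [(hmem hn).eLpNorm_eq_integral_rpow_norm (Nat.cast_ne_zero.2 (by omega))
      (ENNReal.natCast_ne_top _)]
    simp only [ENNReal.toReal_natCast, Real.rpow_natCast, le_refl]

end LpConvergence

end QuasiMean

/-! ### The main theorem -/

open QuasiMean in
theorem theorem4p2 {Ω : Type*} [MeasurableSpace Ω] (P : Measure Ω) [IsProbabilityMeasure P]
    (μ : ℝ) (σ : ℝ≥0) (hσ : 0 < σ)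
    (X : ℕ → Ω → ℝ)
    (hlaw : ∀ i, HasLaw (X i) (cauchyMeasure μ σ) P)
    (hindep : iIndepFun X P)
    (α : ℂ) (hα : 0 ≤ α.im) :
    -- unbiasedness
    (∀ n : ℕ, 2 ≤ n →
      Integrable (fun ω => geomMean α n (fun j => X j ω)) P ∧
      ∫ ω, geomMean α n (fun j => X j ω) ∂P = (μ : ℂ) + (σ : ℝ) * Complex.I) ∧
    -- almost sure convergence
    (∀ᵐ ω ∂P, Tendsto (fun n : ℕ => geomMean α n (fun j => X j ω)) atTop
      (𝓝 ((μ : ℂ) + (σ : ℝ) * Complex.I))) ∧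
    -- convergence in `L^p`
    (∀ p : ℝ≥0∞, 0 < p → p < ∞ →
      (∀ᶠ n : ℕ in atTop, MemLp (fun ω => geomMean α n (fun j => X j ω)) p P) ∧
      Tendsto (fun n : ℕ => eLpNorm
        (fun ω => geomMean α n (fun j => X j ω) - ((μ : ℂ) + (σ : ℝ) * Complex.I)) p P)
        atTop (𝓝 0)) ∧
    -- asymptotic variance
    (Integrable (fun x : ℝ =>
        angle x α.im ^ 2 / ((x - (α.re + μ)) ^ 2 + (σ : ℝ) ^ 2)) volume ∧
      Tendsto (fun n : ℕ => (n : ℝ) * cvar (fun ω => geomMean α n (fun j => X j ω)) P) atTop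
        (𝓝 (2 * ((μ + α.re) ^ 2 + ((σ : ℝ) + α.im) ^ 2) *
          ((σ : ℝ) / Real.pi *
              (∫ x : ℝ, angle x α.im ^ 2 / ((x - (α.re + μ)) ^ 2 + (σ : ℝ) ^ 2))
            - angle (μ + α.re) ((σ : ℝ) + α.im) ^ 2)))) ∧
    -- asymptotic variance for `α = 0`
    (α = 0 → ∀ r θ : ℝ, 0 < r → 0 < θ → θ < Real.pi →
      (μ : ℂ) + (σ : ℝ) * Complex.I = (r : ℂ) * Complex.exp ((θ : ℂ) * Complex.I) →
      Tendsto (fun n : ℕ => (n : ℝ) * cvar (fun ω => geomMean α n (fun j => X j ω)) P) atTop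
        (𝓝 (2 * r ^ 2 * θ * (Real.pi - θ)))) := by
  have hnorm : ‖(μ : ℂ) + (σ : ℝ) * Complex.I + α‖ ^ 2 =
      (μ + α.re) ^ 2 + ((σ : ℝ) + α.im) ^ 2 := by
    rw [← Complex.normSq_eq_norm_sq, Complex.normSq_apply]
    simp
    ring
  have hvar := tendsto_mul_cvar_geomMean hσ hlaw hindep hα
  refine ⟨fun n hn => integral_geomMean hσ hlaw hindep hα hn,
    ae_tendsto_geomMean hσ hlaw hindep hα,
    fun p _ hp => tendsto_eLpNorm_geomMean_sub hσ hlaw hindep hα hp,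
    ⟨integrable_angle_sq_div hσ hα, ?_⟩, ?_⟩
  · rw [integral_angle_sq_div hσ hα, angle_location hσ hα, ← hnorm]
    exact hvar
  · rintro rfl r θ hr hθ0 hθ1 hw
    simp only [add_zero] at hvar
    have harg : ((μ : ℂ) + (σ : ℝ) * Complex.I).arg = θ := by
      rw [hw, Complex.arg_real_mul _ hr, Complex.arg_exp_mul_I, toIocMod_eq_self]
      constructor <;> linarith
    have hr2 : ‖(μ : ℂ) + (σ : ℝ) * Complex.I‖ = r := by
      rw [hw, norm_mul, Complex.norm_exp_ofReal_mul_I, Complex.norm_real,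
        Real.norm_of_nonneg hr.le, mul_one]
    rw [integral_arg_sq_of_real hσ, harg, hr2] at hvar
    rw [show 2 * r ^ 2 * θ * (Real.pi - θ) = 2 * r ^ 2 * (Real.pi * θ - θ ^ 2) by ring]
    exact hvar
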